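/- Let $\mathcal Z,\mathcal X$ be measurable spaces, let $\mathscr C:\mathcal Z\to\mathcal X$ be measurable, and put $X=\mathscr C(Z)$, $x=\mathscr C(z)$. Let $\mathcal M$ be a set of pairwise mutually absolutely continuous probability measures on $\mathcal Z$. For $P\in\mathcal M$ let $P_X$ be the law of $X$ when $Z\sim P$. **Definitions.** For $P\in\mathcal M$ and $s\in L^2(P)$, let $\mathscr P(P,\mathcal M,s)$ be the set of paths $\{P_\epsilon:\epsilon\in[0,1]\}\subseteq\mathcal M$ with $P_0=P$ that are quadratic mean differentiable at $\epsilon=0$ with score $s$, i.e. $\int\big(\sqrt{dP_\epsilon/dP}-1-\tfrac{\epsilon}{2}s\big)^2dP=o(\epsilon^2)$ as $\epsilon\downarrow0$. Let $\check{\mathcal M}_P$ be the set of $s$ with $\mathscr P(P,\mathcal M,s)\ne\emptyset$, and let $\dot{\mathcal M}_P\subseteq L^2(P)$ be its closed linear span. $\mathcal M$ is locally nonparametric at $P$ if $\dot{\mathcal M}_P=\{s\in L^2(P):\int s\,dP=0\}$. For a subset $\mathcal U$ of a Hilbert space $\mathcal T$, $u\in\mathcal U$ and $t\in\mathcal T$,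 let $\mathscr P(u,\mathcal U,t)$ be the set of paths $\{u_\epsilon:\epsilon\in[0,1]\}\subseteq\mathcal U$ with $\|u_\epsilon-u-\epsilon t\|_{\mathcal T}=o(\epsilon)$ as $\epsilon\downarrow0$. Let $\check{\mathcal U}_u$ be the set of $t$ with $\mathscr P(u,\mathcal U,t)\neq\emptyset$, and let $\dot{\mathcal U}_u$ be its closed linear span. A map $\theta:\mathcal M\times\mathcal U\to\mathcal W$ into a Hilbert space is totally pathwise differentiable at $(P,u)$ if there is a continuous linear operator $\dot\theta_{P,u}:\dot{\mathcal M}_P\oplus\dot{\mathcal U}_u\to\mathcal W$ such that $$\big\|\theta(P_\epsilon,u_\epsilon)-\theta(P,u)-\epsilon\,\dot\theta_{P,u}(s,t)\big\|_{\mathcal W}=o(\epsilon)\quad(\epsilon\downarrow0)$$ for all $s\in\check{\mathcal M}_P$, $t\in\check{\mathcal U}_u$, $\{P_\epsilon\}\in\mathscr P(P,\mathcal M,s)$ and $\{u_\epsilon\}\in\mathscr P(u,\mathcal U,t)$. Its Hermitian adjoint is $\dot\theta_{P,u}^*:\mathcal W\to\dot{\mathcal M}_P\oplus\dot{\mathcal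 U}_u$. **Statement.** Let $P,Q\in\mathcal M$, let $\mathcal M$ be locally nonparametric at $P$, let $m<\infty$, and suppose that $\|dQ_X/dP_X\|_{L^\infty(P_X)}<\infty$ and $\|dP/dQ\|_{L^\infty(Q)}<\infty$. (a) *Conditional covariance.* Let $\mathcal U=\{u=(u_1,u_2):\max_j\|u_j\|_{L^\infty(Q)}\le m\}\subset L^2(Q)\oplus L^2(Q)$ and let $\theta:\mathcal M\times\mathcal U\to L^2(Q_X)$ be $\theta(P',u')(x)=\mathrm{cov}_{P'}[u_1'(Z),u_2'(Z)\mid X=x]$. For every $u\in\mathcal U$, $\theta$ is totally pathwise differentiable at $(P,u)$, and for every differential operator $\dot\theta_{P,u}$ as above and every $w\in L^2(Q_X)$, $\dot\theta_{P,u}^*(w)=(\dot\nu_{P,u}^*(w),\dot\zeta_{P,u}^*(w))$ with $$\dot\nu_{P,u}^*(w)(z)=\frac{dQ_X}{dP_X}(x)\,w(x)\Big[\prod_{j=1}^2\{u_j(z)-E_P[u_j(Z)\mid X=x]\}-\theta(P,u)(x)\Big],$$ $$\dot\zeta_{P,u}^*(w)=\Big(z\mapsto\frac{dP}{dQ}(z)\,\frac{dQ_X}{dP_X}(x)\,w(x)\,\{u_{3-j}(z)-E_P[u_{3-j}(Z)\mid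 X=x]\}\Big)_{j=1}^2.$$ (b) *Conditional variance.* Let $\mathcal U=\{u:\|u\|_{L^\infty(Q)}\le m\}\subset L^2(Q)$ and let $\theta:\mathcal M\times\mathcal U\to L^2(Q_X)$ be $\theta(P',u')(x)=\mathrm{Var}_{P'}[u'(Z)\mid X=x]$. For every $u\in\mathcal U$, $\theta$ is totally pathwise differentiable at $(P,u)$, and for every differential operator $\dot\theta_{P,u}$ as above and every $w\in L^2(Q_X)$, $\dot\theta_{P,u}^*(w)=(\dot\nu_{P,u}^*(w),\dot\zeta_{P,u}^*(w))$ with $$\dot\nu_{P,u}^*(w)(z)=\frac{dQ_X}{dP_X}(x)\,w(x)\big[\{u(z)-E_P[u(Z)\mid X=x]\}^2-\theta(P,u)(x)\big],$$ $$\dot\zeta_{P,u}^*(w)(z)=2\,\frac{dP}{dQ}(z)\,\frac{dQ_X}{dP_X}(x)\,w(x)\,\{u(z)-E_P[u(Z)\mid X=x]\}.$$ -/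

import Mathlib

open MeasureTheory Filter Topology Asymptotics Set
open scoped NNReal ENNReal unitInterval

noncomputable section

/-! ### Smooth paths and tangent spaces in a Hilbert space -/

section Hilbert

variable {T : Type*} [NormedAddCommGroup T] [InnerProductSpace ℝ T]

/-- The path `γ : [0,1] → U` belongs to `𝒫(u, U, t)`: `‖γ ε - u - ε t‖ = o(ε)` as `ε ↓ 0`. -/
def IsSmoothPath (U : Set T) (u t : T) (γ : I → U) : Prop :=
  (fun ε : I => ‖(γ ε : T) - u - (ε : ℝ) • t‖) =o[𝓝[>] (0 : I)] fun ε : I => (ε : ℝ)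

/-- The tangent set of `U` at `u`. -/
def tangentSet (U : Set T) (u : T) : Set T :=
  {t | ∃ γ : I → U, IsSmoothPath U u t γ}

/-- The tangent space of `U` at `u`: the closed linear span of the tangent set. -/
def tangentSpace (U : Set T) (u : T) : Submodule ℝ T :=
  (Submodule.span ℝ (tangentSet U u)).topologicalClosure

instance [CompleteSpace T] (U : Set T) (u : T) : CompleteSpace (tangentSpace U u) :=
  inferInstanceAs (CompleteSpace (Submodule.span ℝ (tangentSet U u)).topologicalClosure)

end Hilbert

/-! ### Quadratic mean differentiable submodels -/

section Model

variable {Z : Type*} [MeasurableSpace Z]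

/-- `γ : [0,1] → M` is a quadratic mean differentiable submodel with `γ 0 = P` and score `s` at
`ε = 0`. With `p_ε` and `p` the densities of `γ ε` and `P` with respect to any common dominating
measure `μ`, the usual requirement is `∫ (√p_ε - √p - (ε/2) s √p)² dμ = o(ε²)`. Splitting this
integral over the part of `γ ε` that is absolutely continuous with respect to `P` and the part that
is singular to `P` gives the expression below. -/
def IsQMDPath (M : Set (ProbabilityMeasure Z)) (P : M)
    (s : Lp ℝ 2 ((P : ProbabilityMeasure Z) : Measure Z)) (γ : I → M) : Prop :=
  γ 0 = P ∧
  (fun ε : I =>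
    (∫ z, (√((((γ ε : ProbabilityMeasure Z) : Measure Z).rnDeriv
          ((P : ProbabilityMeasure Z) : Measure Z) z).toReal) - 1 - (ε : ℝ) / 2 * s z) ^ 2
        ∂((P : ProbabilityMeasure Z) : Measure Z))
      + (((γ ε : ProbabilityMeasure Z) : Measure Z).singularPart
          ((P : ProbabilityMeasure Z) : Measure Z)).real univ)
    =o[𝓝[>] (0 : I)] fun ε : I => (ε : ℝ) ^ 2

/-- The tangent set of the model `M` at `P`. -/
def modelTangentSet (M : Set (ProbabilityMeasure Z)) (P : M) :
    Set (Lp ℝ 2 ((P : ProbabilityMeasure Z) : Measure Z)) :=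
  {s | ∃ γ : I → M, IsQMDPath M P s γ}

/-- The tangent space of the model `M` at `P`. -/
def modelTangentSpace (M : Set (ProbabilityMeasure Z)) (P : M) :
    Submodule ℝ (Lp ℝ 2 ((P : ProbabilityMeasure Z) : Measure Z)) :=
  (Submodule.span ℝ (modelTangentSet M P)).topologicalClosure

instance (M : Set (ProbabilityMeasure Z)) (P : M) : CompleteSpace (modelTangentSpace M P) :=
  inferInstanceAs (CompleteSpace (Submodule.span ℝ (modelTangentSet M P)).topologicalClosure)

/-- `M` is locally nonparametric at `P`: its tangent space there is the set of all mean-zero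
elements of `L²(P)`. -/
def IsLocallyNonparametric (M : Set (ProbabilityMeasure Z)) (P : M) : Prop :=
  ∀ s : Lp ℝ 2 ((P : ProbabilityMeasure Z) : Measure Z),
    s ∈ modelTangentSpace M P ↔ ∫ z, s z ∂((P : ProbabilityMeasure Z) : Measure Z) = 0

/-- All distributions in `M` are mutually absolutely continuous. -/
def AllEquivalent (M : Set (ProbabilityMeasure Z)) : Prop :=
  ∀ P ∈ M, ∀ P' ∈ M, (P : Measure Z) ≪ (P' : Measure Z)

/-! ### Total pathwise differentiability -/

variable {T : Type*} [NormedAddCommGroup T] [InnerProductSpace ℝ T]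
  {W : Type*} [NormedAddCommGroup W] [InnerProductSpace ℝ W]

/-- The continuous linear operator `D` on the Hilbert direct sum of the two tangent spaces is a
differential operator of `θ` at `(P, u)`. -/
def HasTotalPathwiseDeriv {M : Set (ProbabilityMeasure Z)} {U : Set T} (θ : M → U → W)
    (P : M) (u : U)
    (D : WithLp 2 (modelTangentSpace M P × tangentSpace U (u : T)) →L[ℝ] W) : Prop :=
  ∀ (s : modelTangentSpace M P) (t : tangentSpace U (u : T)) (Pε : I → M) (uε : I → U),
    IsQMDPath M P s Pε → IsSmoothPath U u t uε →
      (fun ε : I => ‖θ (Pε ε) (uε ε) - θ P u - (ε : ℝ) • D (WithLp.toLp 2 (s, t))‖)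
        =o[𝓝[>] (0 : I)] fun ε : I => (ε : ℝ)

/-- `θ` is totally pathwise differentiable at `(P, u)`. -/
def TotallyPathwiseDifferentiableAt {M : Set (ProbabilityMeasure Z)} {U : Set T} (θ : M → U → W)
    (P : M) (u : U) : Prop :=
  ∃ D : WithLp 2 (modelTangentSpace M P × tangentSpace U (u : T)) →L[ℝ] W,
    HasTotalPathwiseDeriv θ P u D

end Model

/-! ### Conditional means, covariances and variances given `X = C(Z)`, as functions of `x` -/

section Conditional

variable {Z X : Type*} [MeasurableSpace Z] [MeasurableSpace X]

theorem exists_condMean (P : Measure Z) (C : Z → X) (f : Z → ℝ) :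
    ∃ g : X → ℝ, StronglyMeasurable g ∧
      P[f | MeasurableSpace.comap C inferInstance] = g ∘ C :=
  (stronglyMeasurable_condExp (m := MeasurableSpace.comap C inferInstance)).exists_eq_measurable_comp

/-- The function `x ↦ E_P[f(Z) | X = x]`, where `X = C(Z)`: a measurable function on `X` whose
composition with `C` is the conditional expectation of `f` given the σ-algebra generated by `C`. It
is determined up to null sets of the law of `X`. -/
def condMean (P : Measure Z) (C : Z → X) (f : Z → ℝ) : X → ℝ :=
  (exists_condMean P C f).choose

theorem condMean_stronglyMeasurable (P : Measure Z) (C : Z → X) (f : Z → ℝ) :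
    StronglyMeasurable (condMean P C f) :=
  (exists_condMean P C f).choose_spec.1

theorem condMean_comp (P : Measure Z) (C : Z → X) (f : Z → ℝ) :
    P[f | MeasurableSpace.comap C inferInstance] = condMean P C f ∘ C :=
  (exists_condMean P C f).choose_spec.2

/-- The function `x ↦ cov_P[f(Z), g(Z) | X = x]`. -/
def condCov (P : Measure Z) (C : Z → X) (f g : Z → ℝ) : X → ℝ :=
  condMean P C fun z => (f z - condMean P C f (C z)) * (g z - condMean P C g (C z))

/-- The function `x ↦ Var_P[f(Z) | X = x]`. -/
def condVariance (P : Measure Z) (C : Z → X) (f : Z → ℝ) : X → ℝ :=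
  condMean P C fun z => (f z - condMean P C f (C z)) ^ 2

theorem condMean_bound_comp (P : Measure Z) (C : Z → X) {f : Z → ℝ} {R : ℝ}
    (hf : ∀ᵐ z ∂P, |f z| ≤ R) : ∀ᵐ z ∂P, |condMean P C f (C z)| ≤ R := by
  have h := ae_bdd_abs_condExp_of_ae_bdd_abs (m := MeasurableSpace.comap C inferInstance) hf
  rwa [condMean_comp] at h

theorem condMean_bound (P : Measure Z) {C : Z → X} (hC : Measurable C) {f : Z → ℝ} {R : ℝ}
    (hf : ∀ᵐ z ∂P, |f z| ≤ R) : ∀ᵐ x ∂P.map C, |condMean P C f x| ≤ R := by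
  rw [ae_map_iff hC.aemeasurable
    (measurableSet_le (condMean_stronglyMeasurable P C f).measurable.abs measurable_const)]
  exact condMean_bound_comp P C hf

theorem condMean_memLp {P Q : Measure Z} [IsFiniteMeasure Q] (hQP : Q ≪ P) {C : Z → X}
    (hC : Measurable C) {f : Z → ℝ} {R : ℝ} (hf : ∀ᵐ z ∂P, |f z| ≤ R) :
    MemLp (condMean P C f) 2 (Q.map C) :=
  MemLp.of_bound (condMean_stronglyMeasurable P C f).aestronglyMeasurable R
    ((hQP.map hC).ae_le (condMean_bound P hC hf))

theorem condCov_memLp {P Q : Measure Z} [IsFiniteMeasure Q] (hQP : Q ≪ P) {C : Z → X}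
    (hC : Measurable C) {f g : Z → ℝ} {m : ℝ} (hf : ∀ᵐ z ∂P, |f z| ≤ m)
    (hg : ∀ᵐ z ∂P, |g z| ≤ m) : MemLp (condCov P C f g) 2 (Q.map C) := by
  refine condMean_memLp hQP hC (R := (m + m) * (m + m)) ?_
  filter_upwards [hf, hg, condMean_bound_comp P C hf, condMean_bound_comp P C hg]
    with z h1 h2 h3 h4
  have hm : 0 ≤ m := (abs_nonneg _).trans h1
  rw [abs_mul]
  exact mul_le_mul ((abs_sub _ _).trans (add_le_add h1 h3))
    ((abs_sub _ _).trans (add_le_add h2 h4)) (abs_nonneg _) (by positivity)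

theorem condVariance_memLp {P Q : Measure Z} [IsFiniteMeasure Q] (hQP : Q ≪ P) {C : Z → X}
    (hC : Measurable C) {f : Z → ℝ} {m : ℝ} (hf : ∀ᵐ z ∂P, |f z| ≤ m) :
    MemLp (condVariance P C f) 2 (Q.map C) := by
  have h := condCov_memLp hQP hC hf hf
  simpa only [condCov, condVariance, sq] using h

/-! ### The primitives -/

/-- `{u = (u₁, u₂) : max_j ‖u_j‖_{L^∞(Q)} ≤ m}`, as a subset of `L²(Q) ⊕ L²(Q)`. The coordinates are
indexed by `Fin 2`, so that `Fin.rev j` is the index other than `j`. -/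
def boundedPairs (Q : Measure Z) (m : ℝ) : Set (PiLp 2 fun _ : Fin 2 => Lp ℝ 2 Q) :=
  {u | ∀ j, ∀ᵐ z ∂Q, |u j z| ≤ m}

/-- `{u : ‖u‖_{L^∞(Q)} ≤ m}`, as a subset of `L²(Q)`. -/
def boundedFunctions (Q : Measure Z) (m : ℝ) : Set (Lp ℝ 2 Q) :=
  {u | ∀ᵐ z ∂Q, |u z| ≤ m}

/-- The conditional covariance primitive `(P, u) ↦ cov_P[u₁(Z), u₂(Z) | X = ·] ∈ L²(Q_X)`. -/
def condCovMap {M : Set (ProbabilityMeasure Z)} (hM : AllEquivalent M) (Q : M) {C : Z → X}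
    (hC : Measurable C) (m : ℝ) (P : M)
    (u : boundedPairs ((Q : ProbabilityMeasure Z) : Measure Z) m) :
    Lp ℝ 2 (((Q : ProbabilityMeasure Z) : Measure Z).map C) :=
  (condCov_memLp (P := ((P : ProbabilityMeasure Z) : Measure Z)) (hM _ Q.2 _ P.2) hC
    ((hM _ P.2 _ Q.2).ae_le (u.2 0)) ((hM _ P.2 _ Q.2).ae_le (u.2 1))).toLp
    (condCov ((P : ProbabilityMeasure Z) : Measure Z) C (u.1 0) (u.1 1))

/-- The conditional variance primitive `(P, u) ↦ Var_P[u(Z) | X = ·] ∈ L²(Q_X)`. -/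
def condVarianceMap {M : Set (ProbabilityMeasure Z)} (hM : AllEquivalent M) (Q : M) {C : Z → X}
    (hC : Measurable C) (m : ℝ) (P : M)
    (u : boundedFunctions ((Q : ProbabilityMeasure Z) : Measure Z) m) :
    Lp ℝ 2 (((Q : ProbabilityMeasure Z) : Measure Z).map C) :=
  (condVariance_memLp (P := ((P : ProbabilityMeasure Z) : Measure Z)) (hM _ Q.2 _ P.2) hC
    ((hM _ P.2 _ Q.2).ae_le u.2)).toLp
    (condVariance ((P : ProbabilityMeasure Z) : Measure Z) C u.1)

/-- The density `dP/dQ`, as a real-valued function. -/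
abbrev density (P Q : Measure Z) (z : Z) : ℝ := (P.rnDeriv Q z).toReal

end Conditional

end

/-! Write `E[·|X]` for conditional expectation under `P` given the σ-algebra of `C`. Everything is
expanded on `Z`, in `L²(P)`, and only the limit is moved to `L²(Q_X)`; this transfer, like that of
the `u`-paths from `L²(Q)` to `L²(P)`, costs only a bounded density.

Perturbing `P`: put `d = √(dP'/dP) - 1` and `η² = E[d²|X]`. The density is `1 + 2d + d²`, so Bayes'
formula writes `E_{P'}[g|X]`, for bounded `g` with `E[g|X] = 0`, as `(2E[dg|X] + E[d²g|X]) / (1 +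
2E[d|X] + η²)`. Its first order term is `2E[dg|X]`, with error at most a constant times `η · min 1
η` (`condExp_change_of_measure_expansion`). An error `η²` would only be small in `L¹`; the
truncation makes it `o(ε)` in `L²`, because `η/ε` is dominated by an `L²`-convergent family while
`min 1 η` is bounded and tends to zero (`tendstoL2_truncated_condNorm`). Recentering at the
conditional means under `P` turns the change of the covariance into such a term plus a product of
two conditional means of centered functions, each `O(min 1 η)` (`condCov_change_of_measure`).

Perturbing `u` under fixed `P`: the covariance is bilinear in the centered functions, which gives a
product rule. Altogether (`tendstoL2_condCov`) the derivative is `E[sG|X] + E[t₁g₂|X] + E[t₂g₁|X]`,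
where `g₁, g₂` are the centered functions and `G` is `g₁g₂` minus its conditional mean.

Adjoint: `∫ w E[fG|X] dQ_X = ∫ (dQ_X/dP_X)(X) w(X) f G dP`, and a further factor `dP/dQ` turns this
into an integral against `Q`. The resulting representers must lie in the tangent spaces. In the
model direction `E[G|X] = 0` gives mean zero, and local nonparametricity applies. In the `u`
direction the tangent space is everything if `m > 0`, and the representer is zero if `m ≤ 0`.
Finally the derivative is unique, since it is determined on tangent sets whose spans are dense, so
the formulas hold for every differential operator. -/

noncomputable section

/-! ### Convergence in `L²` along a filter -/

section TendstoL2

variable {ι Ω : Type*} {m0 : MeasurableSpace Ω} {μ ν : Measure Ω} {l : Filter ι}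
  {f g f' : ι → Ω → ℝ} {f₀ g₀ f₀' : Ω → ℝ}

/-- The square integrable functions `f i` converge in `L²(μ)` to the square integrable `f₀`. -/
structure TendstoL2 {ι Ω : Type*} {_ : MeasurableSpace Ω} (μ : Measure Ω) (l : Filter ι)
    (f : ι → Ω → ℝ) (f₀ : Ω → ℝ) : Prop where
  -- Asked at every index, not just eventually. Difference quotients meet this even at `ε = 0`,
  -- where division by zero gives the zero function.
  memLp : ∀ i, MemLp (f i) 2 μ
  memLp_lim : MemLp f₀ 2 μ
  tendsto : Tendsto (fun i => eLpNorm (f i - f₀) 2 μ) l (𝓝 0)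

namespace TendstoL2

theorem const (l : Filter ι) (h : MemLp f₀ 2 μ) : TendstoL2 μ l (fun _ => f₀) f₀ :=
  ⟨fun _ => h, h, by simpa using tendsto_const_nhds⟩

theorem add (hf : TendstoL2 μ l f f₀) (hg : TendstoL2 μ l g g₀) :
    TendstoL2 μ l (fun i => f i + g i) (f₀ + g₀) := by
  refine ⟨fun i => (hf.memLp i).add (hg.memLp i), hf.memLp_lim.add hg.memLp_lim, ?_⟩
  have h := hf.tendsto.add hg.tendsto
  rw [add_zero] at h
  refine tendsto_of_tendsto_of_tendsto_of_le_of_le tendsto_const_nhds h (fun _ => zero_le)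
    fun i => ?_
  have e : f i + g i - (f₀ + g₀) = (f i - f₀) + (g i - g₀) := by ring
  simp only [e]
  exact eLpNorm_add_le ((hf.memLp i).sub hf.memLp_lim).1 ((hg.memLp i).sub hg.memLp_lim).1
    one_le_two

theorem const_mul (c : ℝ) (hf : TendstoL2 μ l f f₀) :
    TendstoL2 μ l (fun i z => c * f i z) (fun z => c * f₀ z) := by
  refine ⟨fun i => (hf.memLp i).const_mul c, hf.memLp_lim.const_mul c, ?_⟩
  have h := ENNReal.Tendsto.const_mul (a := ‖c‖ₑ) hf.tendsto (Or.inr (by simp))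
  rw [mul_zero] at h
  refine h.congr fun i => ?_
  have e : ((fun z => c * f i z) - fun z => c * f₀ z) = c • (f i - f₀) := by
    ext z; simp [mul_sub]
  rw [e, eLpNorm_const_smul]

theorem neg (hf : TendstoL2 μ l f f₀) : TendstoL2 μ l (fun i => -f i) (-f₀) := by
  have h := hf.const_mul (-1)
  simp only [neg_one_mul] at h
  exact h

theorem sub (hf : TendstoL2 μ l f f₀) (hg : TendstoL2 μ l g g₀) :
    TendstoL2 μ l (fun i => f i - g i) (f₀ - g₀) := by
  simpa only [sub_eq_add_neg] using hf.add hg.neg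

theorem sub_lim (hf : TendstoL2 μ l f f₀) : TendstoL2 μ l (fun i => f i - f₀) 0 := by
  simpa using hf.sub (const l hf.memLp_lim)

theorem congr (hf : TendstoL2 μ l f f₀) (hf' : ∀ i, MemLp (f' i) 2 μ)
    (h : ∀ᶠ i in l, f i =ᵐ[μ] f' i) (h₀ : f₀ =ᵐ[μ] f₀') : TendstoL2 μ l f' f₀' := by
  refine ⟨hf', hf.memLp_lim.ae_eq h₀, hf.tendsto.congr' ?_⟩
  filter_upwards [h] with i hi
  exact eLpNorm_congr_ae (hi.sub h₀)

theorem congr_lim (hf : TendstoL2 μ l f f₀) (h₀ : f₀ =ᵐ[μ] f₀') : TendstoL2 μ l f f₀' :=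
  hf.congr hf.memLp (Eventually.of_forall fun _ => ae_eq_refl _) h₀

theorem squeeze_zero (hg : TendstoL2 μ l g 0) (hf : ∀ i, MemLp (f i) 2 μ)
    (h : ∀ᶠ i in l, ∀ᵐ z ∂μ, |f i z| ≤ g i z) : TendstoL2 μ l f 0 := by
  refine ⟨hf, MemLp.zero, ?_⟩
  refine tendsto_of_tendsto_of_tendsto_of_le_of_le' tendsto_const_nhds hg.tendsto
    (Eventually.of_forall fun _ => zero_le) ?_
  filter_upwards [h] with i hi
  simp only [sub_zero]
  exact eLpNorm_mono_ae_real hi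

theorem of_sub {h : ι → Ω → ℝ} (hf' : TendstoL2 μ l f' f₀) (hh : TendstoL2 μ l h 0)
    (hf : ∀ i, MemLp (f i) 2 μ) (e : ∀ᶠ i in l, f i =ᵐ[μ] f' i + h i) : TendstoL2 μ l f f₀ := by
  have := hf'.add hh
  rw [add_zero] at this
  exact this.congr hf (e.mono fun i hi => hi.symm) (ae_eq_refl _)

theorem smul_zero {e : ι → ℝ} (he : Tendsto e l (𝓝 0)) (hf : TendstoL2 μ l f f₀) :
    TendstoL2 μ l (fun i z => e i * f i z) 0 := by
  refine ⟨fun i => (hf.memLp i).const_mul _, MemLp.zero, ?_⟩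
  have he' : Tendsto (fun i => ‖e i‖ₑ) l (𝓝 0) := by
    simpa only [enorm_zero] using he.enorm
  have h1 := ENNReal.Tendsto.mul he' (Or.inr ENNReal.zero_ne_top) hf.tendsto
    (Or.inr ENNReal.zero_ne_top)
  have h2 := ENNReal.Tendsto.mul_const (b := eLpNorm f₀ 2 μ) he'
    (Or.inr hf.memLp_lim.2.ne)
  have h3 := h1.add h2
  simp only [mul_zero, zero_mul, add_zero] at h3
  refine tendsto_of_tendsto_of_tendsto_of_le_of_le tendsto_const_nhds h3 (fun _ => zero_le)
    fun i => ?_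
  simp only [sub_zero]
  have e1 : (fun z => e i * f i z) = e i • ((f i - f₀) + f₀) := by ext z; simp
  rw [e1, eLpNorm_const_smul, ← mul_add]
  gcongr
  exact eLpNorm_add_le ((hf.memLp i).sub hf.memLp_lim).1 hf.memLp_lim.1 one_le_two

/-- Conditional expectation is linear and contracts the `L²` norm. -/
theorem condExp [IsFiniteMeasure μ] (m : MeasurableSpace Ω) (hf : TendstoL2 μ l f f₀) :
    TendstoL2 μ l (fun i => μ[f i | m]) (μ[f₀ | m]) := by
  refine ⟨fun i => (hf.memLp i).condExp one_le_two, hf.memLp_lim.condExp one_le_two, ?_⟩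
  refine tendsto_of_tendsto_of_tendsto_of_le_of_le tendsto_const_nhds hf.tendsto
    (fun _ => zero_le) fun i => ?_
  refine le_trans (le_of_eq (eLpNorm_congr_ae ?_))
    (eLpNorm_condExp_le_eLpNorm (m := m) (f i - f₀) one_le_two)
  exact (_root_.MeasureTheory.condExp_sub ((hf.memLp i).integrable one_le_two)
    (hf.memLp_lim.integrable one_le_two) m).symm

/-- The essential bounds on `dP/dQ` and `dQ_X/dP_X` enter the expansion here: a bounded density
makes one `L²` norm a multiple of the other. -/
theorem of_measure_le_smul {c : ℝ≥0∞} (hc : c ≠ ∞) (h : ν ≤ c • μ) (hf : TendstoL2 μ l f f₀) :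
    TendstoL2 ν l f f₀ := by
  refine ⟨fun i => (hf.memLp i).of_measure_le_smul hc h, hf.memLp_lim.of_measure_le_smul hc h, ?_⟩
  have h3 := ENNReal.Tendsto.const_mul (a := c ^ (1 / (2 : ℝ≥0∞)).toReal) hf.tendsto
    (Or.inr (ENNReal.rpow_ne_top_of_nonneg (by positivity) hc))
  rw [mul_zero] at h3
  refine tendsto_of_tendsto_of_tendsto_of_le_of_le tendsto_const_nhds h3 (fun _ => zero_le)
    fun i => ?_
  exact eLpNorm_le_of_measure_le_smul (f := f i - f₀) h

end TendstoL2

theorem MemLp.mul_of_ae_bound {f g : Ω → ℝ} {K : ℝ} (hf : MemLp f 2 μ)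
    (hg : AEStronglyMeasurable g μ) (h : ∀ᵐ z ∂μ, |g z| ≤ K) :
    MemLp (fun z => f z * g z) 2 μ := by
  have := (memLp_top_of_bound hg K h).mul hf (r := 2)
  exact this

theorem eLpNorm_mul_le_of_ae_bound {f g : Ω → ℝ} {K : ℝ} (h : ∀ᵐ z ∂μ, |g z| ≤ K) :
    eLpNorm (fun z => f z * g z) 2 μ ≤ ENNReal.ofReal K * eLpNorm f 2 μ := by
  refine eLpNorm_le_mul_eLpNorm_of_ae_le_mul ?_ 2
  filter_upwards [h] with z hz
  rw [norm_mul, mul_comm]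
  exact mul_le_mul_of_nonneg_right hz (norm_nonneg _)

namespace TendstoL2

/-- Split `f₀ = (f₀ - k) + k` with `k` simple. The first piece is small uniformly in `i` because `g
i` is bounded by `K`; the second tends to zero because `k` is bounded and `g i → 0` in `L²`. -/
theorem fixed_mul_zero {K : ℝ} (hf : MemLp f₀ 2 μ) (hg : TendstoL2 μ l g 0)
    (hK : ∀ i, ∀ᵐ z ∂μ, |g i z| ≤ K) : TendstoL2 μ l (fun i z => f₀ z * g i z) 0 := by
  refine ⟨fun i => MemLp.mul_of_ae_bound hf (hg.memLp i).1 (hK i), MemLp.zero, ?_⟩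
  simp only [sub_zero]
  have hg0 := hg.tendsto
  simp only [sub_zero] at hg0
  rw [ENNReal.tendsto_nhds_zero]
  intro δ hδ
  rcases eq_or_ne δ ∞ with rfl | hδt
  · simp
  obtain ⟨k, hk, hkm⟩ := hf.exists_simpleFunc_eLpNorm_sub_lt (by simp)
    -- The `+ 1` keeps the denominator nonzero when `ENNReal.ofReal K = 0`.
    (ε := δ / 2 / (ENNReal.ofReal K + 1))
    (ENNReal.div_pos (ENNReal.half_pos hδ.ne').ne' (by simp)).ne'
  obtain ⟨B, hB⟩ := k.exists_forall_norm_le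
  have h1 := ENNReal.Tendsto.const_mul (a := ENNReal.ofReal B) hg0 (Or.inr (by simp))
  rw [mul_zero, ENNReal.tendsto_nhds_zero] at h1
  filter_upwards [h1 (δ / 2) (ENNReal.half_pos hδ.ne')] with i hi
  have e : (fun z => f₀ z * g i z)
      = (fun z => (f₀ - k) z * g i z) + fun z => g i z * k z := by
    ext z; simp; ring
  rw [e]
  refine (eLpNorm_add_le ((hf.sub hkm).1.mul (hg.memLp i).1) ((hg.memLp i).1.mul hkm.1)
    one_le_two).trans ?_
  rw [← ENNReal.add_halves δ]
  refine add_le_add ?_ ((eLpNorm_mul_le_of_ae_bound (Eventually.of_forall hB)).trans hi)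
  refine (eLpNorm_mul_le_of_ae_bound (hK i)).trans ?_
  calc ENNReal.ofReal K * eLpNorm (f₀ - ⇑k) 2 μ
      ≤ (ENNReal.ofReal K + 1) * (δ / 2 / (ENNReal.ofReal K + 1)) := by
        gcongr
        exact le_self_add
    _ ≤ δ / 2 := ENNReal.mul_div_le

/-- `L²` convergence of both factors alone would give only `L¹` convergence of the product; a
uniform bound on one factor restores `L²`. -/
theorem mul_bounded {K : ℝ} (hf : TendstoL2 μ l f f₀) (hg : TendstoL2 μ l g g₀)
    (hK : ∀ i, ∀ᵐ z ∂μ, |g i z| ≤ K) (hK₀ : ∀ᵐ z ∂μ, |g₀ z| ≤ K) :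
    TendstoL2 μ l (fun i z => f i z * g i z) (fun z => f₀ z * g₀ z) := by
  have hm : ∀ i, MemLp (fun z => f i z * g i z) 2 μ := fun i =>
    MemLp.mul_of_ae_bound (hf.memLp i) (hg.memLp i).1 (hK i)
  have h1 : TendstoL2 μ l (fun i z => f₀ z * (g i - g₀) z) 0 := by
    refine fixed_mul_zero (K := K + K) hf.memLp_lim hg.sub_lim fun i => ?_
    filter_upwards [hK i, hK₀] with z h1 h2
    exact (abs_sub _ _).trans (add_le_add h1 h2)
  have h2 : TendstoL2 μ l (fun i z => (f i - f₀) z * g i z) 0 := by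
    refine ⟨fun i => MemLp.mul_of_ae_bound ((hf.memLp i).sub hf.memLp_lim) (hg.memLp i).1 (hK i),
      MemLp.zero, ?_⟩
    have h3 := ENNReal.Tendsto.const_mul (a := ENNReal.ofReal K) hf.tendsto (Or.inr (by simp))
    rw [mul_zero] at h3
    refine tendsto_of_tendsto_of_tendsto_of_le_of_le tendsto_const_nhds h3 (fun _ => zero_le)
      fun i => ?_
    simp only [sub_zero]
    exact eLpNorm_mul_le_of_ae_bound (hK i)
  have h3 := h1.add h2
  rw [add_zero] at h3
  refine (const l (MemLp.mul_of_ae_bound hf.memLp_lim hg.memLp_lim.1 hK₀)).of_sub h3 hm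
    (Eventually.of_forall fun i => Eventually.of_forall fun z => ?_)
  simp; ring

end TendstoL2

end TendstoL2

/-! ### Conditional expectations under a change of measure -/

section ChangeOfMeasure

variable {Ω : Type*} {m m0 : MeasurableSpace Ω} {P P' : Measure Ω}

theorem Integrable.of_ae_bound {μ : Measure Ω} [IsFiniteMeasure μ] {f : Ω → ℝ} {K : ℝ}
    (hf : AEStronglyMeasurable f μ) (h : ∀ᵐ z ∂μ, |f z| ≤ K) : Integrable f μ :=
  ⟨hf, HasFiniteIntegral.of_bounded h⟩

theorem ae_bound_sub_condExp {μ : Measure Ω} {f : Ω → ℝ} {K : ℝ} (h : ∀ᵐ z ∂μ, |f z| ≤ K) :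
    ∀ᵐ z ∂μ, |f z - (μ[f | m]) z| ≤ K + K := by
  filter_upwards [h, ae_bdd_abs_condExp_of_ae_bdd_abs (m := m) h] with z h1 h2
  exact (abs_sub _ _).trans (add_le_add h1 h2)

theorem ae_bound_mul {μ : Measure Ω} {f g : Ω → ℝ} {K L : ℝ} (hf : ∀ᵐ z ∂μ, |f z| ≤ K)
    (hg : ∀ᵐ z ∂μ, |g z| ≤ L) : ∀ᵐ z ∂μ, |f z * g z| ≤ K * L := by
  filter_upwards [hf, hg] with z h1 h2
  rw [abs_mul]
  exact mul_le_mul h1 h2 (abs_nonneg _) ((abs_nonneg _).trans h1)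

/-- The conditional expectation of a centered function vanishes. -/
theorem condExp_sub_condExp (hm : m ≤ m0) [IsFiniteMeasure P] {f : Ω → ℝ} (hf : Integrable f P) :
    P[f - P[f | m] | m] =ᵐ[P] 0 := by
  refine (condExp_sub hf integrable_condExp m).trans ?_
  rw [condExp_of_stronglyMeasurable hm stronglyMeasurable_condExp integrable_condExp, sub_self]

/-- Conditional Cauchy–Schwarz inequality against the constant function. -/
theorem abs_condExp_le_sqrt (hm : m ≤ m0) [IsFiniteMeasure P] {f : Ω → ℝ} (hf : MemLp f 2 P) :
    ∀ᵐ z ∂P, |(P[f | m]) z| ≤ √((P[fun z => f z ^ 2 | m]) z) := by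
  have h := ConvexOn.map_condExp_le_univ (μ := P) (m := m) (φ := fun x : ℝ => x ^ 2) (f := f) hm
    (even_two.convexOn_pow) (continuous_pow 2).lowerSemicontinuous (hf.integrable one_le_two) hf.integrable_sq
  filter_upwards [h] with z hz
  exact Real.abs_le_sqrt hz

/-- Bayes' formula for the conditional expectation under a change of measure. -/
theorem condExp_mul_condExp_rnDeriv (hm : m ≤ m0) [IsFiniteMeasure P] [IsFiniteMeasure P']
    (h : P' ≪ P) {g : Ω → ℝ} (hg : Integrable g P') :
    (fun z => (P'[g | m]) z * (P[fun z => (P'.rnDeriv P z).toReal | m]) z)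
      =ᵐ[P] P[fun z => (P'.rnDeriv P z).toReal * g z | m] := by
  set p : Ω → ℝ := fun z => (P'.rnDeriv P z).toReal with hp
  have hpi : Integrable p P := Measure.integrable_toReal_rnDeriv
  have hpg : Integrable (fun z => p z * g z) P := (integrable_rnDeriv_smul_iff h).2 hg
  have hpe : Integrable (fun z => p z * (P'[g | m]) z) P :=
    (integrable_rnDeriv_smul_iff h).2 integrable_condExp
  -- Over a set of `m`, both sides integrate to the `P'`-integral of `g`. The `m`-measurable factor
  -- `P'[g | m]` is then pulled out on the right.
  have h1 : P[fun z => p z * g z | m] =ᵐ[P] P[fun z => p z * (P'[g | m]) z | m] := by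
    refine ae_eq_condExp_of_forall_setIntegral_eq hm hpe
      (fun s _ _ => integrable_condExp.integrableOn) (fun s hs _ => ?_)
      stronglyMeasurable_condExp.aestronglyMeasurable
    rw [setIntegral_condExp hm hpg hs]
    have h2 := setIntegral_rnDeriv_smul (f := g) h (hm s hs)
    have h3 := setIntegral_rnDeriv_smul (f := P'[g | m]) h (hm s hs)
    simp only [smul_eq_mul] at h2 h3
    rw [h2, h3, setIntegral_condExp hm hg hs]
  have h2 := condExp_mul_of_stronglyMeasurable_right (μ := P) (f := p) (g := P'[g | m])
    stronglyMeasurable_condExp hpe hpi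
  filter_upwards [h1, h2] with z h1 h2
  rw [h1]
  exact (mul_comm _ _).trans h2.symm

/-- Pointwise estimate for `e = (2ν + κ) / (1 + 2α + η²)`. The a priori bound `|e| ≤ K` replaces any
lower bound on the denominator. For `η ≤ 1`, `|e| ≤ (2 + 1 + 3)Kη`, and feeding this back gives the
error `(1 + 6 · 3)Kη²`. For `η ≥ 1` the trivial bounds suffice. -/
theorem abs_ratio_expansion {e α ν κ η K : ℝ} (he : |e| ≤ K) (hη : 0 ≤ η) (hα : |α| ≤ η)
    (hν : |ν| ≤ K * η) (hκ : |κ| ≤ K * η ^ 2) (h : e * (1 + 2 * α + η ^ 2) = 2 * ν + κ) :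
    |e - 2 * ν| ≤ 19 * K * (η * min 1 η) ∧ |e| ≤ 6 * K * min 1 η := by
  have hK : 0 ≤ K := (abs_nonneg _).trans he
  rcases le_total η 1 with h1 | h1
  · rw [min_eq_right h1]
    have h2 : |2 * α + η ^ 2| ≤ 3 * η := by
      rw [abs_le] at hα ⊢
      constructor <;> nlinarith
    have h3 : |e * (2 * α + η ^ 2)| ≤ K * (3 * η) := by
      rw [abs_mul]; exact mul_le_mul he h2 (abs_nonneg _) hK
    have hKη : K * η ^ 2 ≤ K * η := by nlinarith [mul_nonneg hK hη]
    have h4 : |e| ≤ 6 * K * η := by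
      have : e = 2 * ν + κ - e * (2 * α + η ^ 2) := by linarith
      rw [abs_le] at hν hκ h3
      rw [this, abs_le]
      constructor <;> linarith [hν.1, hν.2, hκ.1, hκ.2, h3.1, h3.2]
    refine ⟨?_, h4⟩
    have h5 : |e * (2 * α + η ^ 2)| ≤ 6 * K * η * (3 * η) := by
      rw [abs_mul]; exact mul_le_mul h4 h2 (abs_nonneg _) (by positivity)
    have : e - 2 * ν = κ - e * (2 * α + η ^ 2) := by linarith
    rw [abs_le] at hκ h5
    rw [this, abs_le]
    constructor <;> nlinarith [hκ.1, hκ.2, h5.1, h5.2]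
  · rw [min_eq_left h1]
    have hKη : K ≤ K * η := by nlinarith
    constructor
    · rw [abs_le] at he hν ⊢
      constructor <;> nlinarith [he.1, he.2, hν.1, hν.2]
    · linarith

theorem memLp_sqrt_rnDeriv [IsFiniteMeasure P] [IsFiniteMeasure P'] :
    MemLp (fun z => √((P'.rnDeriv P z).toReal)) 2 P := by
  rw [memLp_two_iff_integrable_sq ((Measure.measurable_rnDeriv P' P).ennreal_toReal.sqrt.aestronglyMeasurable)]
  simp only [Real.sq_sqrt ENNReal.toReal_nonneg]
  exact Measure.integrable_toReal_rnDeriv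

/-- First order expansion of the conditional mean of a conditionally centered bounded function under
a change of measure, in terms of the conditional `L²` norm of the root density minus one. -/
theorem condExp_change_of_measure_expansion (hm : m ≤ m0) [IsProbabilityMeasure P]
    [IsProbabilityMeasure P'] (h : P' ≪ P) (h' : P ≪ P') {g : Ω → ℝ} {K : ℝ}
    (hg : AEStronglyMeasurable g P) (hK : ∀ᵐ z ∂P, |g z| ≤ K) (h0 : P[g | m] =ᵐ[P] 0)
    {d η : Ω → ℝ} (hd : d = fun z => √((P'.rnDeriv P z).toReal) - 1)
    (hη : η = fun z => √((P[fun z => d z ^ 2 | m]) z)) :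
    (∀ᵐ z ∂P, |(P'[g | m]) z - 2 * (P[fun z => d z * g z | m]) z|
      ≤ 19 * K * (η z * min 1 (η z))) ∧ ∀ᵐ z ∂P, |(P'[g | m]) z| ≤ 6 * K * min 1 (η z) := by
  rw [← eventually_and]
  have hdm : MemLp d 2 P := by rw [hd]; exact memLp_sqrt_rnDeriv.sub (memLp_const 1)
  have hdi : Integrable d P := hdm.integrable one_le_two
  have hdg : MemLp (fun z => d z * g z) 2 P := MemLp.mul_of_ae_bound hdm hg hK
  have hd2 : Integrable (fun z => d z ^ 2) P := hdm.integrable_sq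
  have hgi : Integrable g P := Integrable.of_ae_bound hg hK
  have hd2g : Integrable (fun z => d z ^ 2 * g z) P := hd2.mul_bdd hg hK
  have hKP' : ∀ᵐ z ∂P', |g z| ≤ K := h.ae_le hK
  -- `√p = 1 + d`, squared.
  have hp : (fun z => (P'.rnDeriv P z).toReal) = (fun _ => (1 : ℝ)) + (2 : ℝ) • d + fun z => d z ^ 2 := by
    ext z
    have := Real.sq_sqrt (ENNReal.toReal_nonneg (a := P'.rnDeriv P z))
    simp only [hd, Pi.add_apply, Pi.smul_apply, smul_eq_mul]
    nlinarith
  have hpg : (fun z => (P'.rnDeriv P z).toReal * g z)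
      = g + (2 : ℝ) • (fun z => d z * g z) + fun z => d z ^ 2 * g z := by
    ext z
    have := congrFun hp z
    simp only [Pi.add_apply, Pi.smul_apply, smul_eq_mul] at this ⊢
    rw [this]; ring
  have e1 := condExp_mul_condExp_rnDeriv hm h
    (Integrable.of_ae_bound (hg.mono_ac h) hKP')
  rw [hpg, hp] at e1
  have a1 := condExp_add (((integrable_const (1 : ℝ)).add (hdi.smul (2 : ℝ)))) hd2 m (μ := P)
  have a2 := condExp_add (integrable_const (1 : ℝ)) (hdi.smul (2 : ℝ)) m (μ := P)
  have a3 := condExp_smul (2 : ℝ) d m (μ := P)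
  have b1 := condExp_add (hgi.add ((hdg.integrable one_le_two).smul (2 : ℝ))) hd2g m
  have b2 := condExp_add hgi ((hdg.integrable one_le_two).smul (2 : ℝ)) m
  have b3 := condExp_smul (2 : ℝ) (fun z => d z * g z) m (μ := P)
  have c1 := abs_condExp_le_sqrt (m := m) hm hdm
  have c2 := abs_condExp_le_sqrt (m := m) hm hdg
  -- With `c2`, this is conditional Cauchy–Schwarz: `|E[dg|X]| ≤ Kη`.
  have c3 : P[fun z => (d z * g z) ^ 2 | m] ≤ᵐ[P] P[fun z => K ^ 2 * d z ^ 2 | m] := by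
    refine condExp_mono hdg.integrable_sq (hd2.const_mul _) ?_
    filter_upwards [hK] with z hz
    have := sq_le_sq' (abs_le.1 hz).1 (abs_le.1 hz).2
    rw [mul_pow, mul_comm]
    exact mul_le_mul_of_nonneg_right this (sq_nonneg _)
  have c4 := condExp_smul (K ^ 2) (fun z => d z ^ 2) m (μ := P)
  have c5 : ∀ᵐ z ∂P, |(P[fun z => d z ^ 2 * g z | m]) z| ≤ (P[fun z => K * d z ^ 2 | m]) z := by
    have i1 := condExp_mono (m := m) hd2g (hd2.const_mul K) (by
      filter_upwards [hK] with z hz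
      nlinarith [(abs_le.1 hz).2, sq_nonneg (d z)])
    have i2 := condExp_mono (m := m) (hd2.const_mul K).neg hd2g (by
      filter_upwards [hK] with z hz
      simp only [Pi.neg_apply]
      nlinarith [(abs_le.1 hz).1, sq_nonneg (d z)])
    have i3 := condExp_neg (fun z => K * d z ^ 2) m (μ := P)
    filter_upwards [i1, i2, i3] with z i1 i2 i3
    rw [abs_le]
    rw [i3] at i2
    exact ⟨i2, i1⟩
  have c6 := condExp_smul K (fun z => d z ^ 2) m (μ := P)
  have c7 : 0 ≤ᵐ[P] P[fun z => d z ^ 2 | m] :=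
    condExp_nonneg (Eventually.of_forall fun z => sq_nonneg _)
  -- The a priori bound on `P'[g | m]` holds `P'`-almost everywhere; `P ≪ P'` carries it to `P`.
  have c8 := h'.ae_le (ae_bdd_abs_condExp_of_ae_bdd_abs (m := m) hKP')
  filter_upwards [e1, a1, a2, a3, b1, b2, b3, c1, c2, c3, c4, c5, c6, c7, c8, h0, hK]
    with z e1 a1 a2 a3 b1 b2 b3 c1 c2 c3 c4 c5 c6 c7 c8 h0 hK
  have hK0 : 0 ≤ K := (abs_nonneg _).trans hK
  simp only [Pi.add_apply, Pi.smul_apply, smul_eq_mul, Pi.zero_apply] at a1 a2 a3 b1 b2 b3 c4 c6 c7 h0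
  have hη2 : η z ^ 2 = (P[fun z => d z ^ 2 | m]) z := by rw [hη]; exact Real.sq_sqrt c7
  refine abs_ratio_expansion (α := (P[d | m]) z) (κ := (P[fun z => d z ^ 2 * g z | m]) z) c8 ?_ ?_
    ?_ ?_ ?_
  · rw [hη]; exact Real.sqrt_nonneg _
  · rw [hη]; exact c1
  · refine c2.trans ?_
    rw [Real.sqrt_le_left (by rw [hη]; positivity)]
    refine c3.trans (le_of_eq ?_)
    rw [mul_pow, hη2]
    exact c4
  · refine c5.trans (le_of_eq ?_)
    rw [hη2]
    exact c6
  · rw [condExp_const hm] at a2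
    -- By `h0` the zeroth order term of the numerator vanishes, leaving exactly the relation `e(1 +
    -- 2α + η²) = 2ν + κ`.
    rw [a1, a2, a3, b1, b2, b3, h0] at e1
    rw [hη2]
    linarith

/-- The conditional covariance after recentering. -/
theorem condExp_mul_centered (hm : m ≤ m0) [IsFiniteMeasure P] {f₁ f₂ c₁ c₂ : Ω → ℝ} {K L : ℝ}
    (hf₁ : AEStronglyMeasurable f₁ P) (hf₂ : AEStronglyMeasurable f₂ P)
    (hK₁ : ∀ᵐ z ∂P, |f₁ z| ≤ K) (hK₂ : ∀ᵐ z ∂P, |f₂ z| ≤ K)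
    (hc₁ : StronglyMeasurable[m] c₁) (hc₂ : StronglyMeasurable[m] c₂)
    (hL₁ : ∀ᵐ z ∂P, |c₁ z| ≤ L) (hL₂ : ∀ᵐ z ∂P, |c₂ z| ≤ L) :
    P[fun z => (f₁ z - (P[f₁ | m]) z) * (f₂ z - (P[f₂ | m]) z) | m] =ᵐ[P] fun z =>
      (P[fun z => (f₁ z - c₁ z) * (f₂ z - c₂ z) | m]) z
        - (P[f₁ - c₁ | m]) z * (P[f₂ - c₂ | m]) z := by
  have bd : ∀ {f c : Ω → ℝ}, (∀ᵐ z ∂P, |f z| ≤ K) → (∀ᵐ z ∂P, |c z| ≤ L) →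
      ∀ᵐ z ∂P, |(f - c) z| ≤ K + L := fun h1 h2 => by
    filter_upwards [h1, h2] with z h1 h2
    exact (abs_sub _ _).trans (add_le_add h1 h2)
  have ce : ∀ {f c : Ω → ℝ}, AEStronglyMeasurable f P → (∀ᵐ z ∂P, |f z| ≤ K) →
      StronglyMeasurable[m] c → (∀ᵐ z ∂P, |c z| ≤ L) → P[f | m] =ᵐ[P] c + P[f - c | m] := by
    intro f c hf hK hc hL
    have hci := Integrable.of_ae_bound (hc.mono hm).aestronglyMeasurable hL
    have := condExp_sub (Integrable.of_ae_bound hf hK) hci m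
    rw [condExp_of_stronglyMeasurable hm hc hci] at this
    filter_upwards [this] with z hz
    simp only [Pi.add_apply, hz, Pi.sub_apply]; ring
  set a₁ := f₁ - c₁ with ha₁
  set a₂ := f₂ - c₂ with ha₂
  have ma₁ : AEStronglyMeasurable a₁ P := hf₁.sub (hc₁.mono hm).aestronglyMeasurable
  have ma₂ : AEStronglyMeasurable a₂ P := hf₂.sub (hc₂.mono hm).aestronglyMeasurable
  have ba₁ := bd hK₁ hL₁
  have ba₂ := bd hK₂ hL₂
  rw [← ha₁] at ba₁
  rw [← ha₂] at ba₂
  have mb : ∀ a : Ω → ℝ, AEStronglyMeasurable (P[a | m]) P := fun a =>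
    (stronglyMeasurable_condExp.mono hm).aestronglyMeasurable
  have bb₁ := ae_bdd_abs_condExp_of_ae_bdd_abs (m := m) ba₁
  have bb₂ := ae_bdd_abs_condExp_of_ae_bdd_abs (m := m) ba₂
  have i11 : Integrable (a₁ * a₂) P := Integrable.of_ae_bound (ma₁.mul ma₂) (ae_bound_mul ba₁ ba₂)
  have i12 : Integrable (a₁ * P[a₂ | m]) P :=
    Integrable.of_ae_bound (ma₁.mul (mb _)) (ae_bound_mul ba₁ bb₂)
  have i21 : Integrable (P[a₁ | m] * a₂) P :=
    Integrable.of_ae_bound ((mb _).mul ma₂) (ae_bound_mul bb₁ ba₂)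
  have i22 : Integrable (P[a₁ | m] * P[a₂ | m]) P :=
    Integrable.of_ae_bound ((mb _).mul (mb _)) (ae_bound_mul bb₁ bb₂)
  -- Subtracting the `m`-measurable `c` does not change a centered function: `f - P[f | m] = a - P[a
  -- | m]`. After expansion, three of the four products have conditional mean `± P[a₁ | m] * P[a₂ |
  -- m]`, with net sign minus.
  have key : (fun z => (f₁ z - (P[f₁ | m]) z) * (f₂ z - (P[f₂ | m]) z)) =ᵐ[P]
      a₁ * a₂ - a₁ * P[a₂ | m] - (P[a₁ | m] * a₂ - P[a₁ | m] * P[a₂ | m]) := by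
    filter_upwards [ce hf₁ hK₁ hc₁ hL₁, ce hf₂ hK₂ hc₂ hL₂] with z h1 h2
    simp only [Pi.sub_apply, Pi.mul_apply, h1, h2, Pi.add_apply, ha₁, ha₂]
    ring
  have s1 := condExp_sub (i11.sub i12) (i21.sub i22) m
  have s2 := condExp_sub i11 i12 m
  have s3 := condExp_sub i21 i22 m
  have s4 := condExp_mul_of_stronglyMeasurable_right (μ := P) stronglyMeasurable_condExp i12
    (Integrable.of_ae_bound ma₁ ba₁)
  have s5 := condExp_mul_of_stronglyMeasurable_left (μ := P) stronglyMeasurable_condExp i21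
    (Integrable.of_ae_bound ma₂ ba₂)
  have s6 := condExp_of_stronglyMeasurable hm
    ((stronglyMeasurable_condExp (f := a₁) (m := m) (μ := P)).mul
      (stronglyMeasurable_condExp (f := a₂) (m := m) (μ := P))) i22
  filter_upwards [condExp_congr_ae (m := m) key, s1, s2, s3, s4, s5] with z k s1 s2 s3 s4 s5
  rw [k, s1, Pi.sub_apply, s2, s3, Pi.sub_apply, Pi.sub_apply, s4, s5, s6]
  simp only [Pi.mul_apply]
  have : (fun z => (f₁ z - c₁ z) * (f₂ z - c₂ z)) = a₁ * a₂ := rfl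
  rw [this]
  ring

end ChangeOfMeasure

/-! ### First order expansion of the conditional covariance -/

section Expansion

variable {ι Ω : Type*} {m m0 : MeasurableSpace Ω} {P : Measure Ω} {l : Filter ι}

/-- No integrability of `f` is needed: if `f²` is not integrable, its `condExp` is zero. -/
theorem memLp_sqrt_condExp_sq (hm : m ≤ m0) [IsFiniteMeasure P] (f : Ω → ℝ) :
    MemLp (fun z => √((P[fun z => f z ^ 2 | m]) z)) 2 P := by
  have hms : AEStronglyMeasurable (fun z => √((P[fun z => f z ^ 2 | m]) z)) P :=
    (stronglyMeasurable_condExp.mono hm).measurable.sqrt.aestronglyMeasurable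
  rw [memLp_two_iff_integrable_sq hms]
  refine integrable_condExp.congr (f := P[fun z => f z ^ 2 | m]) ?_
  have : 0 ≤ᵐ[P] P[fun z => f z ^ 2 | m] :=
    condExp_nonneg (Eventually.of_forall fun z => sq_nonneg _)
  filter_upwards [this] with z hz
  exact (Real.sq_sqrt hz).symm

theorem eLpNorm_sqrt_condExp_sq (hm : m ≤ m0) [IsFiniteMeasure P] {f : Ω → ℝ} (hf : MemLp f 2 P) :
    eLpNorm (fun z => √((P[fun z => f z ^ 2 | m]) z)) 2 P = eLpNorm f 2 P := by
  rw [(memLp_sqrt_condExp_sq hm f).eLpNorm_eq_integral_rpow_norm (by simp) (by simp),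
    hf.eLpNorm_eq_integral_rpow_norm (by simp) (by simp)]
  congr 2
  simp only [ENNReal.toReal_ofNat, Real.rpow_ofNat, Real.norm_eq_abs, sq_abs]
  rw [← integral_condExp hm (f := fun z => f z ^ 2)]
  refine integral_congr_ae ?_
  have : 0 ≤ᵐ[P] P[fun z => f z ^ 2 | m] :=
    condExp_nonneg (Eventually.of_forall fun z => sq_nonneg _)
  filter_upwards [this] with z hz
  exact Real.sq_sqrt hz

theorem TendstoL2.sqrt_condExp_sq (hm : m ≤ m0) [IsFiniteMeasure P] {f : ι → Ω → ℝ}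
    (hf : TendstoL2 P l f 0) : TendstoL2 P l (fun i z => √((P[fun z => f i z ^ 2 | m]) z)) 0 := by
  refine ⟨fun i => memLp_sqrt_condExp_sq hm _, MemLp.zero, ?_⟩
  have := hf.tendsto
  simp only [sub_zero] at this ⊢
  exact this.congr fun i => (eLpNorm_sqrt_condExp_sq hm (hf.memLp i)).symm

theorem TendstoL2.of_div {e : ι → ℝ} (he : Tendsto e l (𝓝 0)) (he0 : ∀ᶠ i in l, 0 < e i)
    {f : ι → Ω → ℝ} {f₀ t : Ω → ℝ} (hf : ∀ i, MemLp (f i) 2 P) (hf₀ : MemLp f₀ 2 P)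
    (h : TendstoL2 P l (fun i z => (f i z - f₀ z) / e i) t) : TendstoL2 P l f f₀ := by
  refine (TendstoL2.const l hf₀).of_sub (h.smul_zero he) hf ?_
  filter_upwards [he0] with i hi
  refine Eventually.of_forall fun z => ?_
  simp only [Pi.add_apply]
  field_simp
  ring

/-- The conditional triangle inequality for `d = (e/2)(s + (2d/e - s))`, with the factor `1/2` given
away. It dominates `η/e` by a family converging in `L²`. -/
theorem sqrt_condExp_sq_le [IsFiniteMeasure P] {d s : Ω → ℝ} {e : ℝ} (he : 0 < e)
    (hd : MemLp d 2 P) (hs : MemLp s 2 P) :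
    ∀ᵐ z ∂P, √((P[fun z => d z ^ 2 | m]) z) ≤ e * (√((P[fun z => s z ^ 2 | m]) z)
      + √((P[fun z => (2 * d z / e - s z) ^ 2 | m]) z)) := by
  have hds : MemLp (fun z => 2 * d z / e - s z) 2 P := by
    simp only [div_eq_mul_inv]
    exact ((hd.const_mul 2).mul_const e⁻¹).sub hs
  have h1 := condExp_mono (m := m) hd.integrable_sq
    (((hs.integrable_sq).add (hds.integrable_sq)).smul (e ^ 2)) (by
      refine Eventually.of_forall fun z => ?_
      simp only [Pi.smul_apply, Pi.add_apply, smul_eq_mul]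
      -- Then `(a + b)²/4 ≤ a² + b²` bounds the square.
      have : d z = e / 2 * (s z + (2 * d z / e - s z)) := by field_simp; ring
      calc d z ^ 2 = e ^ 2 * ((s z + (2 * d z / e - s z)) ^ 2 / 4) := by
            conv_lhs => rw [this]
            ring
        _ ≤ _ := by
            gcongr
            nlinarith [sq_nonneg (s z - (2 * d z / e - s z)), sq_nonneg (s z),
              sq_nonneg (2 * d z / e - s z)])
  have h2 := condExp_smul (e ^ 2) ((fun z => s z ^ 2) + fun z => (2 * d z / e - s z) ^ 2) m (μ := P)
  have h3 := condExp_add hs.integrable_sq hds.integrable_sq m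
  have p1 : 0 ≤ᵐ[P] P[fun z => s z ^ 2 | m] :=
    condExp_nonneg (Eventually.of_forall fun z => sq_nonneg _)
  have p2 : 0 ≤ᵐ[P] P[fun z => (2 * d z / e - s z) ^ 2 | m] :=
    condExp_nonneg (Eventually.of_forall fun z => sq_nonneg _)
  filter_upwards [h1, h2, h3, p1, p2] with z h1 h2 h3 p1 p2
  rw [h2, Pi.smul_apply, h3, smul_eq_mul, Pi.add_apply] at h1
  simp only [Pi.zero_apply] at p1 p2
  rw [Real.sqrt_le_left (by positivity)]
  refine h1.trans ?_
  rw [mul_pow]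
  gcongr
  nlinarith [Real.sq_sqrt p1, Real.sq_sqrt p2, Real.sqrt_nonneg ((P[fun z => s z ^ 2 | m]) z),
    Real.sqrt_nonneg ((P[fun z => (2 * d z / e - s z) ^ 2 | m]) z),
    mul_nonneg (Real.sqrt_nonneg ((P[fun z => s z ^ 2 | m]) z))
    (Real.sqrt_nonneg ((P[fun z => (2 * d z / e - s z) ^ 2 | m]) z))]

/-- If `d i` is of first order in `L²`, then the product of its conditional `L²` norm with the
truncation of that norm is of smaller order. -/
theorem tendstoL2_truncated_condNorm (hm : m ≤ m0) [IsFiniteMeasure P] {e : ι → ℝ}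
    (he : Tendsto e l (𝓝 0)) (he0 : ∀ᶠ i in l, 0 < e i) {d η : ι → Ω → ℝ} {s : Ω → ℝ}
    (hd : ∀ i, MemLp (d i) 2 P) (hs : TendstoL2 P l (fun i z => 2 * d i z / e i) s)
    (hη : ∀ i, η i = fun z => √((P[fun z => d i z ^ 2 | m]) z)) :
    TendstoL2 P l (fun i z => η i z * min 1 (η i z) / e i) 0 := by
  have hηm : ∀ i, MemLp (η i) 2 P := fun i => by rw [hη]; exact memLp_sqrt_condExp_sq hm _
  have hη0 : ∀ i z, 0 ≤ η i z := fun i z => by rw [hη]; exact Real.sqrt_nonneg _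
  have hminm : ∀ i, AEStronglyMeasurable (fun z => min 1 (η i z)) P := fun i =>
    (aestronglyMeasurable_const (b := (1 : ℝ))).inf (hηm i).1
  have hmin1 : ∀ i, ∀ᵐ z ∂P, |min 1 (η i z)| ≤ 1 := fun i => Eventually.of_forall fun z => by
    rw [abs_of_nonneg (le_min zero_le_one (hη0 i z))]
    exact min_le_left _ _
  have hd0 : TendstoL2 P l d 0 := by
    refine (TendstoL2.of_div (f := fun i z => 2 * d i z) (f₀ := 0) he he0
      (fun i => (hd i).const_mul 2) MemLp.zero (by simpa using hs)).const_mul (1 / 2) |>.congr hd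
      (Eventually.of_forall fun i => Eventually.of_forall fun z => ?_)
      (Eventually.of_forall fun z => ?_)
    · simp
    · simp
  have hηt : TendstoL2 P l η 0 := by
    rw [funext hη]
    exact hd0.sqrt_condExp_sq hm
  have hmint : TendstoL2 P l (fun i z => min 1 (η i z)) 0 := by
    refine hηt.squeeze_zero (fun i => MemLp.of_bound (hminm i) 1 (hmin1 i))
      (Eventually.of_forall fun i => Eventually.of_forall fun z => ?_)
    rw [abs_of_nonneg (le_min zero_le_one (hη0 i z))]
    exact min_le_right _ _
  -- This family converges in `L²` and dominates `η i / e i`; multiplied by `min 1 (η i)`, which is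
  -- bounded by one and tends to zero, it tends to zero in `L²`.
  have hk := (TendstoL2.const l (memLp_sqrt_condExp_sq hm s (P := P))).add
    (hs.sub_lim.sqrt_condExp_sq hm)
  have hprod := hk.mul_bounded hmint hmin1 (Eventually.of_forall fun z => by simp)
  simp only [Pi.zero_apply, mul_zero] at hprod
  refine TendstoL2.squeeze_zero hprod (fun i => ?_) ?_
  · have := (MemLp.mul_of_ae_bound (hηm i) (hminm i) (hmin1 i)).mul_const (e i)⁻¹
    simpa only [div_eq_mul_inv] using this
  · filter_upwards [he0] with i hi
    filter_upwards [sqrt_condExp_sq_le hi (hd i) hs.memLp_lim] with z hz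
    have hmn : 0 ≤ min 1 (η i z) := le_min zero_le_one (hη0 i z)
    rw [abs_of_nonneg (div_nonneg (mul_nonneg (hη0 i z) hmn) hi.le), mul_div_right_comm]
    refine mul_le_mul_of_nonneg_right ?_ hmn
    rw [div_le_iff₀' hi]
    simp only [hη]
    exact hz

theorem ae_bound_condCov {μ : Measure Ω} {f₁ f₂ : Ω → ℝ} {K : ℝ} (h₁ : ∀ᵐ z ∂μ, |f₁ z| ≤ K)
    (h₂ : ∀ᵐ z ∂μ, |f₂ z| ≤ K) :
    ∀ᵐ z ∂μ, |(μ[fun z => (f₁ z - (μ[f₁ | m]) z) * (f₂ z - (μ[f₂ | m]) z) | m]) z|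
      ≤ (K + K) * (K + K) :=
  ae_bdd_abs_condExp_of_ae_bdd_abs
    (ae_bound_mul (ae_bound_sub_condExp h₁) (ae_bound_sub_condExp h₂))

/-- Expansion of the conditional covariance in the probability measure only. -/
theorem condCov_change_of_measure (hm : m ≤ m0) [IsProbabilityMeasure P] {P' : Measure Ω}
    [IsProbabilityMeasure P'] (h : P' ≪ P) (h' : P ≪ P') {f₁ f₂ g₁ g₂ G : Ω → ℝ} {K : ℝ}
    (hf₁ : AEStronglyMeasurable f₁ P) (hf₂ : AEStronglyMeasurable f₂ P)
    (hK₁ : ∀ᵐ z ∂P, |f₁ z| ≤ K) (hK₂ : ∀ᵐ z ∂P, |f₂ z| ≤ K) (hg₁ : g₁ = f₁ - P[f₁ | m])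
    (hg₂ : g₂ = f₂ - P[f₂ | m])
    (hG : G = (fun z => g₁ z * g₂ z) - P[fun z => g₁ z * g₂ z | m])
    {d η : Ω → ℝ} (hd : d = fun z => √((P'.rnDeriv P z).toReal) - 1)
    (hη : η = fun z => √((P[fun z => d z ^ 2 | m]) z)) :
    ∀ᵐ z ∂P, |(P'[fun z => (f₁ z - (P'[f₁ | m]) z) * (f₂ z - (P'[f₂ | m]) z) | m]) z
      - (P[fun z => g₁ z * g₂ z | m]) z - 2 * (P[fun z => d z * G z | m]) z|
      ≤ 296 * K ^ 2 * (η z * min 1 (η z)) := by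
  have mg₁ : AEStronglyMeasurable g₁ P := by
    rw [hg₁]; exact hf₁.sub (stronglyMeasurable_condExp.mono hm).aestronglyMeasurable
  have mg₂ : AEStronglyMeasurable g₂ P := by
    rw [hg₂]; exact hf₂.sub (stronglyMeasurable_condExp.mono hm).aestronglyMeasurable
  have bg₁ : ∀ᵐ z ∂P, |g₁ z| ≤ K + K := by rw [hg₁]; exact ae_bound_sub_condExp hK₁
  have bg₂ : ∀ᵐ z ∂P, |g₂ z| ≤ K + K := by rw [hg₂]; exact ae_bound_sub_condExp hK₂
  have mH : AEStronglyMeasurable (fun z => g₁ z * g₂ z) P := mg₁.mul mg₂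
  have bH := ae_bound_mul bg₁ bg₂
  have iH := Integrable.of_ae_bound mH bH
  have mG : AEStronglyMeasurable G P := by
    rw [hG]; exact mH.sub (stronglyMeasurable_condExp.mono hm).aestronglyMeasurable
  have bG : ∀ᵐ z ∂P, |G z| ≤ (K + K) * (K + K) + (K + K) * (K + K) := by
    rw [hG]; exact ae_bound_sub_condExp bH
  have cg₁ : P[g₁ | m] =ᵐ[P] 0 := by
    rw [hg₁]; exact condExp_sub_condExp hm (Integrable.of_ae_bound hf₁ hK₁)
  have cg₂ : P[g₂ | m] =ᵐ[P] 0 := by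
    rw [hg₂]; exact condExp_sub_condExp hm (Integrable.of_ae_bound hf₂ hK₂)
  have cG : P[G | m] =ᵐ[P] 0 := by rw [hG]; exact condExp_sub_condExp hm iH
  have x₁ := (condExp_change_of_measure_expansion hm h h' mg₁ bg₁ cg₁ hd hη).2
  have x₂ := (condExp_change_of_measure_expansion hm h h' mg₂ bg₂ cg₂ hd hη).2
  have xG := (condExp_change_of_measure_expansion hm h h' mG bG cG hd hη).1
  -- Under `P'` the functions are recentered at their conditional means under `P`, so that the
  -- expansion for `P`-centered functions applies to each piece.
  have cc := h'.ae_le (condExp_mul_centered (m := m) (P := P') hm (c₁ := P[f₁ | m])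
    (c₂ := P[f₂ | m]) (hf₁.mono_ac h) (hf₂.mono_ac h) (h.ae_le hK₁) (h.ae_le hK₂)
    stronglyMeasurable_condExp stronglyMeasurable_condExp
    (h.ae_le (ae_bdd_abs_condExp_of_ae_bdd_abs hK₁))
    (h.ae_le (ae_bdd_abs_condExp_of_ae_bdd_abs hK₂)))
  have iP'H : Integrable (P[fun z => g₁ z * g₂ z | m]) P' :=
    Integrable.of_ae_bound (stronglyMeasurable_condExp.mono hm).aestronglyMeasurable
      (h.ae_le (ae_bdd_abs_condExp_of_ae_bdd_abs bH))
  have sG := h'.ae_le (condExp_sub (Integrable.of_ae_bound (mH.mono_ac h) (h.ae_le bH)) iP'H m)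
  rw [← hG, condExp_of_stronglyMeasurable hm stronglyMeasurable_condExp iP'H] at sG
  filter_upwards [x₁, x₂, xG, cc, sG, hK₁] with z x₁ x₂ xG cc sG hKz
  have hη0 : 0 ≤ η z := by rw [hη]; exact Real.sqrt_nonneg _
  have hK0 : 0 ≤ K := (abs_nonneg _).trans hKz
  have e1 : (fun z => (f₁ z - (P[f₁ | m]) z) * (f₂ z - (P[f₂ | m]) z))
      = fun z => g₁ z * g₂ z := by rw [hg₁, hg₂]; rfl
  rw [cc, e1, ← hg₁, ← hg₂]
  rw [Pi.sub_apply] at sG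
  have hmn : 0 ≤ min 1 (η z) := le_min zero_le_one hη0
  have hprod : |(P'[g₁ | m]) z * (P'[g₂ | m]) z| ≤ 144 * K ^ 2 * (η z * min 1 (η z)) := by
    rw [abs_mul]
    refine (mul_le_mul x₁ x₂ (abs_nonneg _) (by positivity)).trans ?_
    have : min 1 (η z) * min 1 (η z) ≤ η z * min 1 (η z) :=
      mul_le_mul_of_nonneg_right (min_le_right _ _) hmn
    have := mul_le_mul_of_nonneg_left this (show 0 ≤ 144 * K ^ 2 by positivity)
    linarith
  have e2 : (P'[fun z => g₁ z * g₂ z | m]) z - (P'[g₁ | m]) z * (P'[g₂ | m]) z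
      - (P[fun z => g₁ z * g₂ z | m]) z - 2 * (P[fun z => d z * G z | m]) z
      = ((P'[G | m]) z - 2 * (P[fun z => d z * G z | m]) z)
        - (P'[g₁ | m]) z * (P'[g₂ | m]) z := by rw [sG]; ring
  rw [e2]
  refine (abs_sub _ _).trans ((add_le_add xG hprod).trans (le_of_eq ?_))
  -- `|G| ≤ 8K²` contributes `19 · 8 = 152`, and the product of the two means, with `|g₁|, |g₂| ≤
  -- 2K`, contributes `(6 · 2)² = 144`; the sum is `296`.
  ring

/-- The derivative of the conditional covariance along a quadratic mean differentiable submodel and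
smooth paths of bounded functions. -/
theorem tendstoL2_condCov (hm : m ≤ m0) [IsProbabilityMeasure P] {Pε : ι → Measure Ω}
    [∀ i, IsProbabilityMeasure (Pε i)] (h : ∀ i, Pε i ≪ P) (h' : ∀ i, P ≪ Pε i) {e : ι → ℝ}
    (he : Tendsto e l (𝓝 0)) (he0 : ∀ᶠ i in l, 0 < e i) {s : Ω → ℝ}
    (hs : TendstoL2 P l (fun i z => 2 * (√(((Pε i).rnDeriv P z).toReal) - 1) / e i) s)
    {u₁ u₂ : ι → Ω → ℝ} {v₁ v₂ t₁ t₂ g₁ g₂ G : Ω → ℝ} {K : ℝ}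
    (hu₁ : ∀ i, AEStronglyMeasurable (u₁ i) P) (hu₂ : ∀ i, AEStronglyMeasurable (u₂ i) P)
    (hv₁ : AEStronglyMeasurable v₁ P) (hv₂ : AEStronglyMeasurable v₂ P)
    (hK₁ : ∀ i, ∀ᵐ z ∂P, |u₁ i z| ≤ K) (hK₂ : ∀ i, ∀ᵐ z ∂P, |u₂ i z| ≤ K)
    (hL₁ : ∀ᵐ z ∂P, |v₁ z| ≤ K) (hL₂ : ∀ᵐ z ∂P, |v₂ z| ≤ K)
    (ht₁ : TendstoL2 P l (fun i z => (u₁ i z - v₁ z) / e i) t₁)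
    (ht₂ : TendstoL2 P l (fun i z => (u₂ i z - v₂ z) / e i) t₂)
    (hg₁ : g₁ = v₁ - P[v₁ | m]) (hg₂ : g₂ = v₂ - P[v₂ | m])
    (hG : G = (fun z => g₁ z * g₂ z) - P[fun z => g₁ z * g₂ z | m]) :
    TendstoL2 P l (fun i z =>
      (((Pε i)[fun z => (u₁ i z - ((Pε i)[u₁ i | m]) z) * (u₂ i z - ((Pε i)[u₂ i | m]) z) | m]) z
        - (P[fun z => (v₁ z - (P[v₁ | m]) z) * (v₂ z - (P[v₂ | m]) z) | m]) z) / e i)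
      (P[fun z => s z * G z | m] + (P[fun z => t₁ z * g₂ z | m] + P[fun z => t₂ z * g₁ z | m])) := by
  have mce : ∀ {μ : Measure Ω} (f : Ω → ℝ), AEStronglyMeasurable (μ[f | m]) P := fun f =>
    (stronglyMeasurable_condExp.mono hm).aestronglyMeasurable
  set d : ι → Ω → ℝ := fun i z => √(((Pε i).rnDeriv P z).toReal) - 1 with hd
  set η : ι → Ω → ℝ := fun i z => √((P[fun z => d i z ^ 2 | m]) z) with hη
  have hdm : ∀ i, MemLp (d i) 2 P := fun i => memLp_sqrt_rnDeriv.sub (memLp_const 1)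
  have hR := tendstoL2_truncated_condNorm hm he he0 hdm hs (η := η) fun i => rfl
  set a₁ : ι → Ω → ℝ := fun i => u₁ i - P[u₁ i | m] with ha₁
  set a₂ : ι → Ω → ℝ := fun i => u₂ i - P[u₂ i | m] with ha₂
  set τ₁ : ι → Ω → ℝ := fun i z => (u₁ i z - v₁ z) / e i with hτ₁
  set τ₂ : ι → Ω → ℝ := fun i z => (u₂ i z - v₂ z) / e i with hτ₂
  have lu₁ : ∀ i, MemLp (u₁ i) 2 P := fun i => MemLp.of_bound (hu₁ i) K (hK₁ i)
  have lu₂ : ∀ i, MemLp (u₂ i) 2 P := fun i => MemLp.of_bound (hu₂ i) K (hK₂ i)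
  have lv₁ : MemLp v₁ 2 P := MemLp.of_bound hv₁ K hL₁
  have lv₂ : MemLp v₂ 2 P := MemLp.of_bound hv₂ K hL₂
  have hu₁t : TendstoL2 P l u₁ v₁ := TendstoL2.of_div he he0 lu₁ lv₁ ht₁
  have hu₂t : TendstoL2 P l u₂ v₂ := TendstoL2.of_div he he0 lu₂ lv₂ ht₂
  have ha₁t : TendstoL2 P l a₁ g₁ := by rw [hg₁]; exact hu₁t.sub (hu₁t.condExp m)
  have ha₂t : TendstoL2 P l a₂ g₂ := by rw [hg₂]; exact hu₂t.sub (hu₂t.condExp m)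
  have ba₁ : ∀ i, ∀ᵐ z ∂P, |a₁ i z| ≤ K + K := fun i => ae_bound_sub_condExp (hK₁ i)
  have ba₂ : ∀ i, ∀ᵐ z ∂P, |a₂ i z| ≤ K + K := fun i => ae_bound_sub_condExp (hK₂ i)
  have bg₁ : ∀ᵐ z ∂P, |g₁ z| ≤ K + K := by rw [hg₁]; exact ae_bound_sub_condExp hL₁
  have bg₂ : ∀ᵐ z ∂P, |g₂ z| ≤ K + K := by rw [hg₂]; exact ae_bound_sub_condExp hL₂
  have hHt : TendstoL2 P l (fun i z => a₁ i z * a₂ i z) (fun z => g₁ z * g₂ z) :=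
    ha₁t.mul_bounded ha₂t ba₂ bg₂
  set Gε : ι → Ω → ℝ := fun i => (fun z => a₁ i z * a₂ i z) - P[fun z => a₁ i z * a₂ i z | m]
    with hGε
  have hGt : TendstoL2 P l Gε G := by rw [hG]; exact hHt.sub (hHt.condExp m)
  have bGε : ∀ i, ∀ᵐ z ∂P, |Gε i z| ≤ (K + K) * (K + K) + (K + K) * (K + K) := fun i =>
    ae_bound_sub_condExp (ae_bound_mul (ba₁ i) (ba₂ i))
  have bG : ∀ᵐ z ∂P, |G z| ≤ (K + K) * (K + K) + (K + K) * (K + K) := by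
    rw [hG]; exact ae_bound_sub_condExp (ae_bound_mul bg₁ bg₂)
  -- The model part. It is formed with the moving `u₁ i, u₂ i`; the residuals `Gε` are uniformly
  -- bounded, so the score needs only `L²` convergence.
  have hB := (hs.mul_bounded hGt bGε bG).condExp m
  set ρ₁ : ι → Ω → ℝ := fun i => τ₁ i - P[τ₁ i | m] with hρ₁
  set ρ₂ : ι → Ω → ℝ := fun i => τ₂ i - P[τ₂ i | m] with hρ₂
  have hρ₁t : TendstoL2 P l ρ₁ (t₁ - P[t₁ | m]) := ht₁.sub (ht₁.condExp m)
  have hρ₂t : TendstoL2 P l ρ₂ (t₂ - P[t₂ | m]) := ht₂.sub (ht₂.condExp m)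
  -- Product rule: `a₁a₂ - g₁g₂ = (a₁ - g₁)a₂ + (a₂ - g₂)g₁`. In each term the difference quotient
  -- converges in `L²` and the other factor is bounded.
  have hA₁ := hρ₁t.mul_bounded ha₂t ba₂ bg₂
  have hA₂ := hρ₂t.mul_bounded (TendstoL2.const l ha₁t.memLp_lim) (fun _ => bg₁) bg₁
  have hA := (hA₁.condExp m).add (hA₂.condExp m)
  have hAB := hB.add hA
  have hquot : ∀ i, MemLp (fun z =>
      (((Pε i)[fun z => (u₁ i z - ((Pε i)[u₁ i | m]) z) * (u₂ i z - ((Pε i)[u₂ i | m]) z) | m]) z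
        - (P[fun z => (v₁ z - (P[v₁ | m]) z) * (v₂ z - (P[v₂ | m]) z) | m]) z) / e i) 2 P := by
    intro i
    have b1 := (h' i).ae_le (ae_bound_condCov (m := m) ((h i).ae_le (hK₁ i)) ((h i).ae_le (hK₂ i)))
    have b2 := ae_bound_condCov (m := m) hL₁ hL₂
    simp only [div_eq_mul_inv]
    exact ((MemLp.of_bound (mce _) _ b1).sub (MemLp.of_bound (mce _) _ b2)).mul_const (e i)⁻¹
  have hR' := hR.const_mul (296 * K ^ 2)
  simp only [Pi.zero_apply, mul_zero] at hR'
  -- The difference quotient minus its model and `u` parts is the remainder of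
  -- `condCov_change_of_measure` at `u₁ i, u₂ i`, divided by `e i`.
  have hrem := TendstoL2.squeeze_zero hR'
    (f := fun i => (fun z =>
      (((Pε i)[fun z => (u₁ i z - ((Pε i)[u₁ i | m]) z) * (u₂ i z - ((Pε i)[u₂ i | m]) z) | m]) z
        - (P[fun z => (v₁ z - (P[v₁ | m]) z) * (v₂ z - (P[v₂ | m]) z) | m]) z) / e i)
      - (P[fun z => 2 * d i z / e i * Gε i z | m]
        + (P[fun z => ρ₁ i z * a₂ i z | m] + P[fun z => ρ₂ i z * g₁ z | m])))
  -- Centering `t` is immaterial when it is paired with a conditionally centered `g`, since `P[t |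
  -- m]` comes out of the conditional expectation.
  have hcent : ∀ {t g v : Ω → ℝ}, MemLp t 2 P → g = v - P[v | m] → MemLp v 2 P →
      (∀ᵐ z ∂P, |g z| ≤ K + K) →
      P[fun z => (t - P[t | m]) z * g z | m] =ᵐ[P] P[fun z => t z * g z | m] := by
    intro t g v ht hg hv bg
    have hgm : MemLp g 2 P := by rw [hg]; exact hv.sub (hv.condExp one_le_two)
    have i1 : Integrable (fun z => t z * g z) P :=
      (MemLp.mul_of_ae_bound ht hgm.1 bg).integrable one_le_two
    have i2 : Integrable (P[t | m] * g) P :=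
      (MemLp.mul_of_ae_bound (ht.condExp one_le_two) hgm.1 bg).integrable one_le_two
    have s1 := condExp_sub i1 i2 m
    have s2 := condExp_mul_of_stronglyMeasurable_left (μ := P) stronglyMeasurable_condExp i2
      (hgm.integrable one_le_two)
    have s3 := condExp_sub_condExp (m := m) hm (hv.integrable one_le_two)
    rw [← hg] at s3
    have e1 : (fun z => (t - P[t | m]) z * g z) = (fun z => t z * g z) - P[t | m] * g := by
      ext z; simp [sub_mul]
    rw [e1]
    filter_upwards [s1, s2, s3] with z s1 s2 s3
    rw [s1, Pi.sub_apply, s2, Pi.mul_apply, s3]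
    simp
  have hAB' := hAB.of_sub (hrem (fun i => (hquot i).sub (hAB.memLp i)) ?_) hquot
    (Eventually.of_forall fun i => Eventually.of_forall fun z =>
      (add_sub_cancel _ _).symm)
  · refine hAB'.congr_lim ?_
    filter_upwards [hcent ht₁.memLp_lim hg₂ lv₂ bg₂, hcent ht₂.memLp_lim hg₁ lv₁ bg₁] with z c1 c2
    simp only [Pi.add_apply, c1, c2]
  filter_upwards [he0] with i hi
  have main := condCov_change_of_measure hm (h i) (h' i) (hu₁ i) (hu₂ i) (hK₁ i) (hK₂ i)
    (g₁ := a₁ i) (g₂ := a₂ i) rfl rfl (G := Gε i) rfl (d := d i) (η := η i) rfl rfl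
  have q1 := condExp_smul (2 / e i) (fun z => d i z * Gε i z) m (μ := P)
  have q1' : ((2 / e i) • fun z => d i z * Gε i z) = fun z => 2 * d i z / e i * Gε i z := by
    ext z; simp only [Pi.smul_apply, smul_eq_mul]; ring
  rw [q1'] at q1
  have iρ₁ : Integrable (fun z => ρ₁ i z * a₂ i z) P := (hA₁.memLp i).integrable one_le_two
  have iρ₂ : Integrable (fun z => ρ₂ i z * g₁ z) P := (hA₂.memLp i).integrable one_le_two
  have iH : Integrable (fun z => a₁ i z * a₂ i z) P := (hHt.memLp i).integrable one_le_two
  have iH₀ : Integrable (fun z => g₁ z * g₂ z) P := hHt.memLp_lim.integrable one_le_two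
  have q2 := condExp_smul (e i) ((fun z => ρ₁ i z * a₂ i z) + fun z => ρ₂ i z * g₁ z) m (μ := P)
  have q3 := condExp_add iρ₁ iρ₂ m
  have q4 := condExp_sub iH iH₀ m
  have hρa : ∀ {u : ι → Ω → ℝ} {v : Ω → ℝ}, MemLp (u i) 2 P → MemLp v 2 P →
      (fun z => e i * ((fun z => (u i z - v z) / e i) - P[fun z => (u i z - v z) / e i | m]) z)
        =ᵐ[P] (u i - P[u i | m]) - (v - P[v | m]) := by
    intro u v hu hv
    have r1 := condExp_smul (e i)⁻¹ (u i - v) m (μ := P)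
    have r2 := condExp_sub (hu.integrable one_le_two) (hv.integrable one_le_two) m
    have r3 : (e i)⁻¹ • (u i - v) = fun z => (u i z - v z) / e i := by
      ext z; simp only [Pi.smul_apply, Pi.sub_apply, smul_eq_mul]; ring
    rw [r3] at r1
    filter_upwards [r1, r2] with z r1 r2
    simp only [Pi.sub_apply, r1, Pi.smul_apply, r2, smul_eq_mul]
    field_simp
    ring
  have q5 : (e i) • ((fun z => ρ₁ i z * a₂ i z) + fun z => ρ₂ i z * g₁ z)
      =ᵐ[P] (fun z => a₁ i z * a₂ i z) - fun z => g₁ z * g₂ z := by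
    have r1 := hρa (lu₁ i) lv₁
    have r2 := hρa (lu₂ i) lv₂
    rw [← hg₁] at r1
    rw [← hg₂] at r2
    filter_upwards [r1, r2] with z r1 r2
    have r1' : e i * ρ₁ i z = a₁ i z - g₁ z := r1
    have r2' : e i * ρ₂ i z = a₂ i z - g₂ z := r2
    simp only [Pi.smul_apply, Pi.add_apply, smul_eq_mul, Pi.sub_apply, mul_add, ← mul_assoc, r1',
      r2']
    ring
  have q6 := condExp_congr_ae (m := m) q5
  have e1 : (fun z => (v₁ z - (P[v₁ | m]) z) * (v₂ z - (P[v₂ | m]) z))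
      = fun z => g₁ z * g₂ z := by rw [hg₁, hg₂]; rfl
  rw [e1]
  filter_upwards [main, q1, q2, q3, q4, q6] with z main q1 q2 q3 q4 q6
  rw [q6, q4, Pi.sub_apply, Pi.smul_apply, q3, smul_eq_mul, Pi.add_apply] at q2
  simp only [Pi.sub_apply, Pi.add_apply]
  rw [q1, Pi.smul_apply, smul_eq_mul, mul_div_assoc', le_div_iff₀ hi, ← abs_of_pos hi, ← abs_mul,
    abs_of_pos hi]
  refine le_trans (le_of_eq ?_) main
  congr 1
  field_simp
  linarith

end Expansion

/-! ### Densities -/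

section Densities

variable {Ω : Type*} {m0 : MeasurableSpace Ω} {μ ν : Measure Ω}

/-- Turns an essential bound on a density into a setwise comparison of measures, the form used for
`L²` norms. -/
theorem le_smul_of_essSup_rnDeriv [SigmaFinite μ] [SigmaFinite ν] (h : μ ≪ ν) :
    μ ≤ essSup (μ.rnDeriv ν) ν • ν := by
  conv_lhs => rw [← Measure.withDensity_rnDeriv_eq μ ν h]
  rw [← withDensity_const]
  exact withDensity_mono ae_le_essSup

theorem ae_density_le (h : essSup (μ.rnDeriv ν) ν < ∞) :
    ∀ᵐ z ∂ν, |density μ ν z| ≤ (essSup (μ.rnDeriv ν) ν).toReal := by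
  filter_upwards [ae_le_essSup (f := μ.rnDeriv ν) (μ := ν)] with z hz
  rw [abs_of_nonneg ENNReal.toReal_nonneg]
  exact ENNReal.toReal_mono h.ne hz

/-- Multiplication by a bounded density maps `L²` of the dominated measure to `L²` of the dominating
one. -/
theorem memLp_density_mul [IsFiniteMeasure μ] [IsFiniteMeasure ν] (h : μ ≪ ν)
    (hb : essSup (μ.rnDeriv ν) ν < ∞) {w : Ω → ℝ} (hwm : AEStronglyMeasurable w ν)
    (hw : MemLp w 2 μ) : MemLp (fun z => density μ ν z * w z) 2 ν := by
  have hρ : Measurable (density μ ν) := (Measure.measurable_rnDeriv μ ν).ennreal_toReal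
  refine (memLp_two_iff_integrable_sq (hρ.aestronglyMeasurable.mul hwm)).2 ?_
  -- Of the two density factors in the square, one becomes the change from `ν` to `μ` and the other
  -- is bounded.
  have h1 : Integrable (fun z => w z ^ 2 * density μ ν z) μ :=
    hw.integrable_sq.mul_bdd hρ.aestronglyMeasurable (h.ae_le (ae_density_le hb))
  refine ((integrable_rnDeriv_smul_iff h).2 h1).congr (Eventually.of_forall fun z => ?_)
  simp only [smul_eq_mul, density]
  simp only [Pi.mul_apply]
  ring

theorem integral_density_mul [SigmaFinite μ] [SigmaFinite ν] (h : μ ≪ ν) (f : Ω → ℝ) :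
    ∫ z, density μ ν z * f z ∂ν = ∫ z, f z ∂μ := by
  simpa only [smul_eq_mul] using integral_rnDeriv_smul (f := f) h

end Densities

/-! ### Convergence in `L²` and paths -/

section Paths

variable {ι Ω : Type*} {m0 : MeasurableSpace Ω} {μ : Measure Ω} {l : Filter ι}

/-- Passes between the norm form of differentiability in `Lp` and convergence of difference
quotients of representatives. It is used in both directions: to read the paths and to conclude. -/
theorem isLittleO_iff_tendstoL2 {F : ι → Lp ℝ 2 μ} {F₀ D : Lp ℝ 2 μ} {e : ι → ℝ}
    (he : ∀ᶠ i in l, 0 < e i) : (fun i => ‖F i - F₀ - e i • D‖) =o[l] e ↔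
      TendstoL2 μ l (fun i z => (F i z - F₀ z) / e i) D := by
  have hm : ∀ i, MemLp (fun z => (F i z - F₀ z) / e i) 2 μ := fun i => by
    simp only [div_eq_mul_inv]
    exact ((Lp.memLp (F i)).sub (Lp.memLp F₀)).mul_const (e i)⁻¹
  have key : ∀ᶠ i in l, eLpNorm ((fun z => (F i z - F₀ z) / e i) - ⇑D) 2 μ
      = ENNReal.ofReal (‖F i - F₀ - e i • D‖ / e i) := by
    filter_upwards [he] with i hi
    have h1 : (fun z => (F i z - F₀ z) / e i) - ⇑D
        =ᵐ[μ] ((e i)⁻¹ • (F i - F₀ - e i • D) : Lp ℝ 2 μ) := by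
      filter_upwards [Lp.coeFn_smul (e i)⁻¹ (F i - F₀ - e i • D), Lp.coeFn_sub (F i - F₀) (e i • D),
        Lp.coeFn_sub (F i) F₀, Lp.coeFn_smul (e i) D] with z h1 h2 h3 h4
      rw [h1, Pi.smul_apply, h2]
      simp only [Pi.sub_apply, h3, h4, Pi.smul_apply, smul_eq_mul]
      field_simp
    rw [eLpNorm_congr_ae h1, ← Lp.enorm_def, ← ofReal_norm, norm_smul, Real.norm_eq_abs,
      abs_of_pos (inv_pos.2 hi), inv_mul_eq_div]
  rw [isLittleO_iff_tendsto' (he.mono fun i hi h => absurd h hi.ne')]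
  constructor
  · intro h
    refine ⟨hm, Lp.memLp D, Tendsto.congr' (key.mono fun i hi => hi.symm) ?_⟩
    simpa using ENNReal.tendsto_ofReal h
  · intro h
    have h1 := (ENNReal.tendsto_toReal ENNReal.zero_ne_top).comp h.tendsto
    refine Tendsto.congr' ?_ h1
    filter_upwards [key, he] with i hi hi'
    rw [Function.comp_apply, hi, ENNReal.toReal_ofReal (by positivity)]

theorem eLpNorm_two_eq_ofReal_sqrt {f : Ω → ℝ} (hf : MemLp f 2 μ) :
    eLpNorm f 2 μ = ENNReal.ofReal √(∫ z, f z ^ 2 ∂μ) := by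
  rw [hf.eLpNorm_eq_integral_rpow_norm (by simp) (by simp), Real.sqrt_eq_rpow]
  simp

theorem TendstoL2.map_iff {X : Type*} [MeasurableSpace X] {C : Ω → X} (hC : Measurable C)
    {f : ι → X → ℝ} {f₀ : X → ℝ} (hf : ∀ i, AEStronglyMeasurable (f i) (μ.map C))
    (hf₀ : AEStronglyMeasurable f₀ (μ.map C)) :
    TendstoL2 (μ.map C) l f f₀ ↔ TendstoL2 μ l (fun i => f i ∘ C) (f₀ ∘ C) := by
  have e : ∀ i, eLpNorm (f i - f₀) 2 (μ.map C) = eLpNorm (f i ∘ C - f₀ ∘ C) 2 μ := fun i =>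
    eLpNorm_map_measure ((hf i).sub hf₀) hC.aemeasurable
  constructor
  · rintro ⟨h1, h2, h3⟩
    exact ⟨fun i => (memLp_map_measure_iff (hf i) hC.aemeasurable).1 (h1 i),
      (memLp_map_measure_iff hf₀ hC.aemeasurable).1 h2, by simpa only [e] using h3⟩
  · rintro ⟨h1, h2, h3⟩
    exact ⟨fun i => (memLp_map_measure_iff (hf i) hC.aemeasurable).2 (h1 i),
      (memLp_map_measure_iff hf₀ hC.aemeasurable).2 h2, by simpa only [e] using h3⟩

theorem eventually_pos_unitInterval : ∀ᶠ ε : I in 𝓝[>] (0 : I), 0 < (ε : ℝ) := by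
  filter_upwards [self_mem_nhdsWithin] with ε hε
  exact hε

theorem tendsto_coe_unitInterval : Tendsto (fun ε : I => (ε : ℝ)) (𝓝[>] (0 : I)) (𝓝 0) :=
  (continuous_subtype_val.tendsto' (0 : I) 0 rfl).mono_left nhdsWithin_le_nhds

instance neBot_nhdsGT_unitInterval : (𝓝[>] (0 : I)).NeBot :=
  nhdsGT_neBot_of_exists_gt ⟨1, zero_lt_one⟩

/-- Quadratic mean differentiability as convergence of the difference quotients of the root
densities in `L²`. -/
theorem IsQMDPath.tendstoL2 {M : Set (ProbabilityMeasure Ω)} {P : M}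
    {s : Lp ℝ 2 ((P : ProbabilityMeasure Ω) : Measure Ω)} {γ : I → M} (h : IsQMDPath M P s γ) :
    TendstoL2 ((P : ProbabilityMeasure Ω) : Measure Ω) (𝓝[>] (0 : I)) (fun ε z =>
      2 * (√((((γ ε : ProbabilityMeasure Ω) : Measure Ω).rnDeriv
        ((P : ProbabilityMeasure Ω) : Measure Ω) z).toReal) - 1) / (ε : ℝ)) s := by
  set d : I → Ω → ℝ := fun ε z => √((((γ ε : ProbabilityMeasure Ω) : Measure Ω).rnDeriv P.1 z).toReal)
    - 1 with hd
  have hdm : ∀ ε, MemLp (d ε) 2 (P.1 : Measure Ω) := fun ε => memLp_sqrt_rnDeriv.sub (memLp_const 1)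
  have hm : ∀ ε : I, MemLp (fun z => 2 * d ε z / (ε : ℝ)) 2 (P.1 : Measure Ω) := fun ε => by
    simp only [div_eq_mul_inv]
    exact ((hdm ε).const_mul 2).mul_const _
  refine ⟨hm, Lp.memLp s, ?_⟩
  -- The mass of the singular part is nonnegative and can be dropped.
  have h0 : (fun ε : I => ∫ z, (d ε z - (ε : ℝ) / 2 * s z) ^ 2 ∂(P.1 : Measure Ω)) =o[𝓝[>] (0 : I)]
      fun ε : I => (ε : ℝ) ^ 2 := by
    refine IsBigO.trans_isLittleO ?_ h.2
    refine IsBigO.of_bound 1 (Eventually.of_forall fun ε => ?_)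
    have i0 : 0 ≤ ∫ z, (d ε z - (ε : ℝ) / 2 * s z) ^ 2 ∂(P.1 : Measure Ω) :=
      integral_nonneg fun z => sq_nonneg _
    rw [one_mul, Real.norm_of_nonneg i0]
    refine le_trans ?_ (le_abs_self _)
    exact le_add_of_nonneg_right measureReal_nonneg
  rw [isLittleO_iff_tendsto' (eventually_pos_unitInterval.mono fun ε hε h =>
    absurd h (by positivity))] at h0
  -- The factor comes from `(2d/ε - s)² = 4(d - εs/2)²/ε²`.
  have h1 := ENNReal.tendsto_ofReal ((h0.const_mul 4).sqrt)
  simp only [mul_zero, Real.sqrt_zero, ENNReal.ofReal_zero] at h1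
  refine h1.congr' ?_
  filter_upwards [eventually_pos_unitInterval] with ε hε
  rw [eLpNorm_two_eq_ofReal_sqrt ((hm ε).sub (Lp.memLp s)), mul_div_assoc', mul_comm,
    mul_div_assoc, ← integral_mul_const]
  congr 2
  refine integral_congr_ae (Eventually.of_forall fun z => ?_)
  simp only [Pi.sub_apply]
  field_simp
  ring

/-- Allows the `u` direction to be varied alone when the derivative is shown to be unique. -/
theorem isQMDPath_const {M : Set (ProbabilityMeasure Ω)} (P : M) :
    IsQMDPath M P 0 fun _ => P := by
  refine ⟨rfl, ?_⟩
  have : ∀ ε : I, (∫ z, (√((((P : ProbabilityMeasure Ω) : Measure Ω).rnDeriv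
          ((P : ProbabilityMeasure Ω) : Measure Ω) z).toReal) - 1 - (ε : ℝ) / 2 *
          (0 : Lp ℝ 2 ((P : ProbabilityMeasure Ω) : Measure Ω)) z) ^ 2
        ∂((P : ProbabilityMeasure Ω) : Measure Ω))
      + (((P : ProbabilityMeasure Ω) : Measure Ω).singularPart
          ((P : ProbabilityMeasure Ω) : Measure Ω)).real univ = 0 := by
    intro ε
    rw [Measure.singularPart_self, integral_eq_zero_of_ae]
    · simp
    · filter_upwards [Measure.rnDeriv_self ((P : ProbabilityMeasure Ω) : Measure Ω),
        Lp.coeFn_zero ℝ 2 ((P : ProbabilityMeasure Ω) : Measure Ω)] with z h1 h2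
      rw [h1, h2]
      simp
  simp only [this]
  exact isLittleO_zero _ _

end Paths

/-! ### Uniqueness of the differential operator -/

section Uniqueness

variable {T : Type*} [NormedAddCommGroup T] [InnerProductSpace ℝ T]
  {W : Type*} [NormedAddCommGroup W] [InnerProductSpace ℝ W]

/-- By convexity the straight segment stays in `U`, and its remainder is exactly zero. -/
theorem isSmoothPath_segment {U : Set T} (hU : Convex ℝ U) {u v : T} (hu : u ∈ U) (hv : v ∈ U) :
    v - u ∈ tangentSet U u := by
  refine ⟨fun ε => ⟨u + (ε : ℝ) • (v - u), hU.add_smul_sub_mem hu hv ε.2⟩, ?_⟩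
  simp only [IsSmoothPath, add_sub_cancel_left, sub_self, norm_zero]
  exact isLittleO_zero _ _

theorem isSmoothPath_const {U : Set T} (u : U) : IsSmoothPath U (u : T) 0 fun _ => u := by
  simp only [IsSmoothPath, sub_self, smul_zero, norm_zero]
  exact isLittleO_zero _ _

theorem clm_ext_closure_span {S : Set T} {A B : (Submodule.span ℝ S).topologicalClosure →L[ℝ] W}
    (h : ∀ x (hx : x ∈ S), A ⟨x, subset_closure (Submodule.subset_span hx)⟩
      = B ⟨x, subset_closure (Submodule.subset_span hx)⟩) : A = B := by
  have hd : DenseRange (Set.inclusion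
      (Submodule.le_topologicalClosure (Submodule.span ℝ S) :
        (Submodule.span ℝ S : Set T) ⊆ (Submodule.span ℝ S).topologicalClosure)) :=
    (denseRange_inclusion_iff _).2 (by rw [Submodule.topologicalClosure_coe])
  have he := hd.equalizer A.continuous B.continuous ?_
  · exact ContinuousLinearMap.ext fun x => congrFun he x
  · ext ⟨x, hx⟩
    refine Submodule.span_induction (p := fun x hx => A ⟨x, subset_closure hx⟩
      = B ⟨x, subset_closure hx⟩) h ?_ ?_ ?_ hx
    · exact (map_zero A).trans (map_zero B).symm
    · intro x y hx hy h1 h2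
      exact (map_add A ⟨x, subset_closure hx⟩ ⟨y, subset_closure hy⟩).trans
        ((congrArg₂ (· + ·) h1 h2).trans
          (map_add B ⟨x, subset_closure hx⟩ ⟨y, subset_closure hy⟩).symm)
    · intro a x hx h1
      exact (map_smul A a ⟨x, subset_closure hx⟩).trans
        ((congrArg (a • ·) h1).trans (map_smul B a ⟨x, subset_closure hx⟩).symm)

variable {Z : Type*} [MeasurableSpace Z]

/-- Subtracting the two expansions along the same paths gives `ε(D - D')(s, t) = o(ε)`, which forces
the constant vector to be zero. -/
theorem HasTotalPathwiseDeriv.eq_on {M : Set (ProbabilityMeasure Z)} {U : Set T} {θ : M → U → W}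
    {P : M} {u : U} {D D' : WithLp 2 (modelTangentSpace M P × tangentSpace U (u : T)) →L[ℝ] W}
    (h : HasTotalPathwiseDeriv θ P u D) (h' : HasTotalPathwiseDeriv θ P u D')
    {s : modelTangentSpace M P} {t : tangentSpace U (u : T)} {Pε : I → M} {uε : I → U}
    (hP : IsQMDPath M P s Pε) (hu : IsSmoothPath U u t uε) :
    D (WithLp.toLp 2 (s, t)) = D' (WithLp.toLp 2 (s, t)) := by
  have h1 := (h s t Pε uε hP hu).of_norm_left
  have h2 := (h' s t Pε uε hP hu).of_norm_left
  have h3 := h2.sub h1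
  have h4 : (fun ε : I => (ε : ℝ) • (D (WithLp.toLp 2 (s, t)) - D' (WithLp.toLp 2 (s, t))))
      =o[𝓝[>] (0 : I)] fun ε : I => (ε : ℝ) := by
    refine h3.congr_left fun ε => ?_
    rw [smul_sub]
    abel
  have h5 := (isLittleO_iff_tendsto' (eventually_pos_unitInterval.mono fun ε hε h =>
    absurd h hε.ne')).1 h4.norm_left
  have h6 : Tendsto (fun _ : I => ‖D (WithLp.toLp 2 (s, t)) - D' (WithLp.toLp 2 (s, t))‖)
      (𝓝[>] (0 : I)) (𝓝 0) := by
    refine h5.congr' ?_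
    filter_upwards [eventually_pos_unitInterval] with ε hε
    rw [norm_smul, Real.norm_of_nonneg hε.le, mul_div_cancel_left₀ _ hε.ne']
  exact sub_eq_zero.1 (norm_eq_zero.1 (tendsto_nhds_unique tendsto_const_nhds h6))

/-- The differential operator is determined by the parameter. -/
theorem HasTotalPathwiseDeriv.unique {M : Set (ProbabilityMeasure Z)} {U : Set T} {θ : M → U → W}
    {P : M} {u : U} {D D' : WithLp 2 (modelTangentSpace M P × tangentSpace U (u : T)) →L[ℝ] W}
    (h : HasTotalPathwiseDeriv θ P u D) (h' : HasTotalPathwiseDeriv θ P u D') : D = D' := by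
  set E := (WithLp.prodContinuousLinearEquiv 2 ℝ (modelTangentSpace M P)
    (tangentSpace U (u : T))).symm.toContinuousLinearMap with hE
  -- By linearity the directions `(s, 0)` and `(0, t)` suffice. Each is realized with a constant
  -- path in the other coordinate, and each tangent space is the closed span of its tangent set.
  have h1 : (D ∘L E) ∘L ContinuousLinearMap.inl ℝ _ _ = (D' ∘L E) ∘L ContinuousLinearMap.inl ℝ _ _ :=
    clm_ext_closure_span (S := modelTangentSet M P) fun s hs => by
      obtain ⟨γ, hγ⟩ := hs
      exact h.eq_on h' (s := ⟨s, _⟩) (t := 0) hγ (isSmoothPath_const u)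
  have h2 : (D ∘L E) ∘L ContinuousLinearMap.inr ℝ _ _ = (D' ∘L E) ∘L ContinuousLinearMap.inr ℝ _ _ :=
    clm_ext_closure_span (S := tangentSet U (u : T)) fun t ht => by
      obtain ⟨γ, hγ⟩ := ht
      exact h.eq_on h' (s := 0) (t := ⟨t, _⟩) (isQMDPath_const P) hγ
  refine ContinuousLinearMap.ext fun x => ?_
  have hx : x = E (ContinuousLinearMap.inl ℝ _ _ x.fst) + E (ContinuousLinearMap.inr ℝ _ _ x.snd) := by
    rw [← map_add]
    simp only [ContinuousLinearMap.inl_apply, ContinuousLinearMap.inr_apply, Prod.mk_add_mk,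
      add_zero, zero_add]
    rfl
  rw [hx, map_add, map_add]
  exact congrArg₂ (· + ·) (congrArg (fun A => A x.fst) h1) (congrArg (fun A => A x.snd) h2)

end Uniqueness

/-! ### Tangent spaces of sets of bounded functions -/

section Bounded

variable {Z : Type*} [MeasurableSpace Z] {Q : Measure Z} {m : ℝ}

theorem convex_boundedFunctions : Convex ℝ (boundedFunctions Q m) := by
  intro f hf g hg a b ha hb hab
  simp only [boundedFunctions, Set.mem_ofPred_eq] at hf hg ⊢
  filter_upwards [hf, hg, Lp.coeFn_add (a • f) (b • g), Lp.coeFn_smul a f, Lp.coeFn_smul b g]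
    with z h1 h2 h3 h4 h5
  rw [h3, Pi.add_apply, h4, h5]
  simp only [Pi.smul_apply, smul_eq_mul]
  calc |a * f z + b * g z| ≤ |a * f z| + |b * g z| := abs_add_le _ _
    _ = a * |f z| + b * |g z| := by rw [abs_mul, abs_mul, abs_of_nonneg ha, abs_of_nonneg hb]
    _ ≤ a * m + b * m := by gcongr
    _ = m := by rw [← add_mul, hab, one_mul]

theorem convex_boundedPairs : Convex ℝ (boundedPairs Q m) := by
  intro f hf g hg a b ha hb hab j
  exact convex_boundedFunctions (hf j) (hg j) ha hb hab

theorem zero_mem_boundedFunctions (hm : 0 ≤ m) : (0 : Lp ℝ 2 Q) ∈ boundedFunctions Q m := by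
  simp only [boundedFunctions, Set.mem_ofPred_eq]
  filter_upwards [Lp.coeFn_zero ℝ 2 Q] with z hz
  rw [hz]
  simpa using hm

/-- `v = (v - u) - (0 - u)` is a difference of two segment directions. -/
theorem mem_tangentSpace_of_mem {T : Type*} [NormedAddCommGroup T] [InnerProductSpace ℝ T]
    {U : Set T} (hU : Convex ℝ U) {u v : T} (hu : u ∈ U) (h0 : (0 : T) ∈ U) (hv : v ∈ U) :
    v ∈ tangentSpace U u := by
  have h1 : ∀ w ∈ U, w - u ∈ tangentSpace U u := fun w hw =>
    subset_closure (Submodule.subset_span (isSmoothPath_segment hU hu hw))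
  have := Submodule.sub_mem _ (h1 v hv) (h1 0 h0)
  simpa using this

/-- A closed subspace of `L²` that contains a ball of `L^∞` is everything. -/
theorem eq_top_of_boundedFunctions_subset (hm : 0 < m) {S : Submodule ℝ (Lp ℝ 2 Q)}
    (hS : IsClosed (S : Set (Lp ℝ 2 Q))) (h : boundedFunctions Q m ⊆ S) : S = ⊤ := by
  rw [Submodule.eq_top_iff']
  intro f
  refine (Lp.simpleFunc.denseRange (p := 2) (E := ℝ) (μ := Q) (by simp)).induction_on f hS
    fun g => ?_
  obtain ⟨B, hB⟩ := (Lp.simpleFunc.toSimpleFunc g).exists_forall_norm_le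
  have hg : ∀ᵐ z ∂Q, |(g : Lp ℝ 2 Q) z| ≤ |B| + 1 := by
    filter_upwards [Lp.simpleFunc.toSimpleFunc_eq_toFun g] with z hz
    rw [← hz]
    exact (hB z).trans ((le_abs_self B).trans (by linarith))
  have hB0 : 0 < |B| + 1 := by positivity
  -- A simple function is bounded, so a positive multiple of it lies in the ball; simple functions
  -- are dense in `L²`.
  have h1 : (m / (|B| + 1)) • (g : Lp ℝ 2 Q) ∈ S := by
    refine h ?_
    simp only [boundedFunctions, Set.mem_ofPred_eq]
    filter_upwards [hg, Lp.coeFn_smul (m / (|B| + 1)) (g : Lp ℝ 2 Q)] with z h1 h2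
    rw [h2, Pi.smul_apply, smul_eq_mul, abs_mul, abs_of_pos (by positivity)]
    calc m / (|B| + 1) * |(g : Lp ℝ 2 Q) z| ≤ m / (|B| + 1) * (|B| + 1) := by gcongr
      _ = m := div_mul_cancel₀ _ hB0.ne'
  exact (Submodule.smul_mem_iff S (by positivity)).1 h1

theorem tangentSpace_boundedFunctions (hm : 0 < m) (u : boundedFunctions Q m) :
    tangentSpace (boundedFunctions Q m) (u : Lp ℝ 2 Q) = ⊤ :=
  eq_top_of_boundedFunctions_subset hm (Submodule.isClosed_topologicalClosure _) fun _ hv =>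
    mem_tangentSpace_of_mem convex_boundedFunctions u.2 (zero_mem_boundedFunctions hm.le) hv

theorem tangentSpace_boundedPairs (hm : 0 < m) (u : boundedPairs Q m) :
    tangentSpace (boundedPairs Q m) (u : PiLp 2 fun _ : Fin 2 => Lp ℝ 2 Q) = ⊤ := by
  have h1 : ∀ (j : Fin 2) (f : Lp ℝ 2 Q),
      PiLp.single 2 j f ∈ tangentSpace (boundedPairs Q m) (u : PiLp 2 fun _ : Fin 2 => Lp ℝ 2 Q) := by
    intro j
    let A : Lp ℝ 2 Q →L[ℝ] PiLp 2 fun _ : Fin 2 => Lp ℝ 2 Q :=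
      (PiLp.continuousLinearEquiv 2 ℝ fun _ : Fin 2 => Lp ℝ 2 Q).symm.toContinuousLinearMap ∘L
        ContinuousLinearMap.single ℝ (fun _ : Fin 2 => Lp ℝ 2 Q) j
    have hA : ∀ f, A f = PiLp.single 2 j f := fun f => rfl
    -- The preimage of the tangent space under the `j`-th coordinate embedding is a closed subspace
    -- containing the ball.
    have := eq_top_of_boundedFunctions_subset hm
      (S := (tangentSpace (boundedPairs Q m) (u : PiLp 2 fun _ : Fin 2 => Lp ℝ 2 Q)).comap
        (A : Lp ℝ 2 Q →ₗ[ℝ] PiLp 2 fun _ : Fin 2 => Lp ℝ 2 Q))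
      ((Submodule.isClosed_topologicalClosure _).preimage A.continuous) fun v hv => by
        refine mem_tangentSpace_of_mem convex_boundedPairs u.2
          (fun j => zero_mem_boundedFunctions hm.le) fun k => ?_
        change ∀ᵐ z ∂Q, |(PiLp.single 2 j v : PiLp 2 fun _ : Fin 2 => Lp ℝ 2 Q) k z| ≤ m
        by_cases hk : k = j
        · subst hk
          rw [PiLp.single_eq_same]
          exact hv
        · rw [PiLp.single_eq_of_ne 2 hk]
          exact zero_mem_boundedFunctions hm.le
    intro f
    have hf : f ∈ (⊤ : Submodule ℝ (Lp ℝ 2 Q)) := Submodule.mem_top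
    rw [← this] at hf
    exact hf
  rw [Submodule.eq_top_iff']
  intro f
  have hf : f = PiLp.single 2 0 (f 0) + PiLp.single 2 1 (f 1) := by
    ext1 j
    fin_cases j <;> simp
  rw [hf]
  exact Submodule.add_mem _ (h1 0 _) (h1 1 _)

end Bounded

/-! ### The conditional mean as an operator between `L²` spaces -/

section CondMeanOperator

variable {Z X : Type*} [MeasurableSpace Z] [MeasurableSpace X] {P μ : Measure Z} {ν : Measure X}
  {C : Z → X} {G : Z → ℝ} {B : ℝ} {c c' : ℝ≥0∞}

theorem ae_map_of_comp_ae_eq (hC : Measurable C) {a b : X → ℝ} (ha : StronglyMeasurable a)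
    (hb : StronglyMeasurable b) (h : a ∘ C =ᵐ[P] b ∘ C) : a =ᵐ[P.map C] b := by
  rw [Filter.EventuallyEq, ae_map_iff hC.aemeasurable
    (measurableSet_eq_fun ha.measurable hb.measurable)]
  exact h

theorem condMean_congr (hC : Measurable C) {f g : Z → ℝ} (h : f =ᵐ[P] g) :
    condMean P C f =ᵐ[P.map C] condMean P C g := by
  refine ae_map_of_comp_ae_eq hC (condMean_stronglyMeasurable _ _ _)
    (condMean_stronglyMeasurable _ _ _) ?_
  rw [← condMean_comp, ← condMean_comp]
  exact condExp_congr_ae h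

theorem condMean_add (hC : Measurable C) {f g : Z → ℝ} (hf : Integrable f P)
    (hg : Integrable g P) : condMean P C (f + g) =ᵐ[P.map C] condMean P C f + condMean P C g := by
  refine ae_map_of_comp_ae_eq hC (condMean_stronglyMeasurable _ _ _)
    ((condMean_stronglyMeasurable _ _ _).add (condMean_stronglyMeasurable _ _ _)) ?_
  rw [Pi.add_comp, ← condMean_comp, ← condMean_comp, ← condMean_comp]
  exact condExp_add hf hg _

theorem condMean_smul (hC : Measurable C) (a : ℝ) (f : Z → ℝ) :
    condMean P C (a • f) =ᵐ[P.map C] a • condMean P C f := by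
  refine ae_map_of_comp_ae_eq hC (condMean_stronglyMeasurable _ _ _)
    ((condMean_stronglyMeasurable _ _ _).const_smul a) ?_
  rw [Pi.smul_comp, ← condMean_comp, ← condMean_comp]
  exact condExp_smul _ _ _

theorem eLpNorm_condMean_le (hC : Measurable C) (hν : ν ≤ c' • P.map C) (f : Z → ℝ) :
    eLpNorm (condMean P C f) 2 ν ≤ c' ^ (1 / (2 : ℝ≥0∞)).toReal * eLpNorm f 2 P := by
  refine (eLpNorm_le_of_measure_le_smul hν).trans ?_
  rw [smul_eq_mul]
  gcongr
  rw [eLpNorm_map_measure (condMean_stronglyMeasurable _ _ _).aestronglyMeasurable hC.aemeasurable,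
    ← condMean_comp]
  exact eLpNorm_condExp_le_eLpNorm f one_le_two

theorem memLp_condMean (hC : Measurable C) (hc' : c' ≠ ∞) (hν : ν ≤ c' • P.map C) {f : Z → ℝ}
    (hf : MemLp f 2 P) : MemLp (condMean P C f) 2 ν :=
  ⟨(condMean_stronglyMeasurable _ _ _).aestronglyMeasurable,
    (eLpNorm_condMean_le hC hν f).trans_lt (ENNReal.mul_lt_top
      (ENNReal.rpow_lt_top_of_nonneg ENNReal.toReal_nonneg hc') hf.2)⟩

/-- For bounded `G`, the operator `f ↦ E_P[f(Z) G(Z) | X = ·]` is continuous from `L²(μ)` to `L²(ν)`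
when `P` is dominated by a multiple of `μ`, and `ν` by a multiple of the law of `X`. -/
theorem exists_condMean_clm [IsFiniteMeasure P] (hC : Measurable C) (hc : c ≠ ∞)
    (hμ : P ≤ c • μ) (hc' : c' ≠ ∞) (hν : ν ≤ c' • P.map C) (hG : AEStronglyMeasurable G P)
    (hB : ∀ᵐ z ∂P, |G z| ≤ B) :
    ∃ A : Lp ℝ 2 μ →L[ℝ] Lp ℝ 2 ν, ∀ f, A f =ᵐ[ν] condMean P C fun z => f z * G z := by
  have hac : P ≪ μ := Measure.absolutelyContinuous_of_le_smul hμ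
  have hνac : ν ≪ P.map C := Measure.absolutelyContinuous_of_le_smul hν
  have hfG : ∀ f : Lp ℝ 2 μ, MemLp (fun z => f z * G z) 2 P := fun f =>
    MemLp.mul_of_ae_bound ((Lp.memLp f).of_measure_le_smul hc hμ) hG hB
  have hm : ∀ f : Lp ℝ 2 μ, MemLp (condMean P C fun z => f z * G z) 2 ν := fun f =>
    memLp_condMean hC hc' hν (hfG f)
  let A₀ : Lp ℝ 2 μ →ₗ[ℝ] Lp ℝ 2 ν :=
    { toFun := fun f => (hm f).toLp _
      map_add' := fun f g => by
        ext1
        have e : (fun z => (f + g : Lp ℝ 2 μ) z * G z)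
            =ᵐ[P] (fun z => f z * G z) + fun z => g z * G z := by
          filter_upwards [hac.ae_le (Lp.coeFn_add f g)] with z hz
          simp only [hz, Pi.add_apply, add_mul]
        filter_upwards [(hm (f + g)).coeFn_toLp, (hm f).coeFn_toLp, (hm g).coeFn_toLp,
          Lp.coeFn_add ((hm f).toLp _) ((hm g).toLp _), hνac.ae_le (condMean_congr hC e),
          hνac.ae_le (condMean_add hC ((hfG f).integrable one_le_two)
            ((hfG g).integrable one_le_two))] with x h1 h2 h3 h4 h5 h6
        rw [h1, h4, Pi.add_apply, h2, h3, h5, h6, Pi.add_apply]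
      map_smul' := fun a f => by
        ext1
        have e : (fun z => (a • f : Lp ℝ 2 μ) z * G z) =ᵐ[P] a • fun z => f z * G z := by
          filter_upwards [hac.ae_le (Lp.coeFn_smul a f)] with z hz
          simp only [hz, Pi.smul_apply, smul_eq_mul, mul_assoc]
        filter_upwards [(hm (a • f)).coeFn_toLp, (hm f).coeFn_toLp,
          Lp.coeFn_smul a ((hm f).toLp _), hνac.ae_le (condMean_congr hC e),
          hνac.ae_le (condMean_smul hC a fun z => f z * G z)] with x h1 h2 h3 h4 h5
        rw [h1, RingHom.id_apply, h3, Pi.smul_apply, h2, h4, h5, Pi.smul_apply] }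
  let K : ℝ≥0∞ := c' ^ (1 / (2 : ℝ≥0∞)).toReal *
    (ENNReal.ofReal B * c ^ (1 / (2 : ℝ≥0∞)).toReal)
  have hK : K ≠ ∞ := ENNReal.mul_ne_top (ENNReal.rpow_ne_top_of_nonneg ENNReal.toReal_nonneg hc')
    (ENNReal.mul_ne_top (by simp) (ENNReal.rpow_ne_top_of_nonneg ENNReal.toReal_nonneg hc))
  refine ⟨A₀.mkContinuous K.toReal fun f => ?_, fun f => (hm f).coeFn_toLp⟩
  change ‖(hm f).toLp _‖ ≤ _
  rw [Lp.norm_toLp, Lp.norm_def, ← ENNReal.toReal_mul]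
  refine ENNReal.toReal_mono (ENNReal.mul_ne_top hK (Lp.memLp f).2.ne) ?_
  refine (eLpNorm_condMean_le hC hν _).trans ?_
  simp only [K, mul_assoc]
  gcongr
  refine (eLpNorm_mul_le_of_ae_bound hB).trans ?_
  gcongr
  exact eLpNorm_le_of_measure_le_smul hμ

/-- The adjoint of the conditional mean operator. -/
theorem integral_mul_condMean [IsFiniteMeasure P] [IsFiniteMeasure ν] (hC : Measurable C)
    (hν : ν ≪ P.map C) (hb : essSup (ν.rnDeriv (P.map C)) (P.map C) < ∞) {w : X → ℝ}
    (hwm : StronglyMeasurable w) (hw : MemLp w 2 ν) {f : Z → ℝ} (hf : MemLp f 2 P) :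
    ∫ x, w x * condMean P C f x ∂ν
      = ∫ z, density ν (P.map C) (C z) * w (C z) * f z ∂P := by
  have hρ : Measurable (density ν (P.map C)) :=
    (Measure.measurable_rnDeriv ν (P.map C)).ennreal_toReal
  have hv : MemLp ((fun x => density ν (P.map C) x * w x) ∘ C) 2 P :=
    (memLp_map_measure_iff (hρ.stronglyMeasurable.mul hwm).aestronglyMeasurable
      hC.aemeasurable).1 (memLp_density_mul hν hb hwm.aestronglyMeasurable hw)
  have hvm : StronglyMeasurable[MeasurableSpace.comap C inferInstance]
      ((fun x => density ν (P.map C) x * w x) ∘ C) :=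
    (hρ.stronglyMeasurable.mul hwm).comp_measurable (comap_measurable C)
  -- The integral is moved to the law of `X`, then pulled back to `Z`. There the weight is
  -- `C`-measurable, and the conditional expectation can be removed.
  rw [← integral_density_mul hν, integral_map hC.aemeasurable
    (f := fun x => density ν (P.map C) x * (w x * condMean P C f x))
    (hρ.stronglyMeasurable.mul (hwm.mul (condMean_stronglyMeasurable _ _ _))).aestronglyMeasurable]
  have h1 := condExp_mul_of_stronglyMeasurable_left (μ := P) hvm (hv.integrable_mul hf)
    (hf.integrable one_le_two)
  have h2 := integral_condExp (μ := P) hC.comap_le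
    (f := ((fun x => density ν (P.map C) x * w x) ∘ C) * f)
  rw [integral_congr_ae h1, condMean_comp] at h2
  refine Eq.trans ?_ h2
  refine integral_congr_ae (Eventually.of_forall fun z => ?_)
  simp only [Pi.mul_apply, Function.comp_apply]
  ring

theorem memLp_density_mul_comp [IsFiniteMeasure P] [IsFiniteMeasure ν] (hC : Measurable C)
    (hν : ν ≪ P.map C) (hb : essSup (ν.rnDeriv (P.map C)) (P.map C) < ∞) {w : X → ℝ}
    (hwm : StronglyMeasurable w) (hw : MemLp w 2 ν) (hG : AEStronglyMeasurable G P)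
    (hB : ∀ᵐ z ∂P, |G z| ≤ B) :
    MemLp (fun z => density ν (P.map C) (C z) * w (C z) * G z) 2 P := by
  have hρ : Measurable (density ν (P.map C)) :=
    (Measure.measurable_rnDeriv ν (P.map C)).ennreal_toReal
  have hv : MemLp ((fun x => density ν (P.map C) x * w x) ∘ C) 2 P :=
    (memLp_map_measure_iff (hρ.stronglyMeasurable.mul hwm).aestronglyMeasurable
      hC.aemeasurable).1 (memLp_density_mul hν hb hwm.aestronglyMeasurable hw)
  exact MemLp.mul_of_ae_bound hv hG hB

end CondMeanOperator

/-! ### Representation of the adjoint -/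

section Adjoint

variable {Z X : Type*} [MeasurableSpace Z] [MeasurableSpace X] {P μ : Measure Z} {ν : Measure X}
  {C : Z → X} {G : Z → ℝ} {B : ℝ}

theorem essSup_rnDeriv_self_lt_top [SigmaFinite μ] : essSup (μ.rnDeriv μ) μ < ∞ := by
  rw [essSup_congr_ae (Measure.rnDeriv_self μ)]
  exact (essSup_le_of_ae_le 1 (Eventually.of_forall fun _ => le_rfl)).trans_lt ENNReal.one_lt_top

/-- The explicit adjoint of `A`. Keeping `μ` general serves both directions: `μ = P` for the model,
where the density is one, and `μ = Q` for the functions. -/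
theorem exists_adjoint_condMean_clm [IsFiniteMeasure P] [IsFiniteMeasure μ] [IsFiniteMeasure ν]
    (hC : Measurable C) (hμ : P ≪ μ) (hbμ : essSup (P.rnDeriv μ) μ < ∞) (hν : ν ≪ P.map C)
    (hb : essSup (ν.rnDeriv (P.map C)) (P.map C) < ∞) (hG : AEStronglyMeasurable G μ)
    (hB : ∀ᵐ z ∂P, |G z| ≤ B) {A : Lp ℝ 2 μ →L[ℝ] Lp ℝ 2 ν}
    (hA : ∀ f, A f =ᵐ[ν] condMean P C fun z => f z * G z) (w : Lp ℝ 2 ν) :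
    ∃ h : Lp ℝ 2 μ, (h =ᵐ[μ] fun z =>
      density P μ z * (density ν (P.map C) (C z) * w (C z) * G z)) ∧
      ∀ f, inner ℝ h f = inner ℝ w (A f) := by
  have hρ : Measurable (density ν (P.map C)) :=
    (Measure.measurable_rnDeriv ν (P.map C)).ennreal_toReal
  have hwm : StronglyMeasurable w := Lp.stronglyMeasurable w
  have h1 := memLp_density_mul_comp hC hν hb hwm (Lp.memLp w) (hG.mono_ac hμ) hB
  have h1m : AEStronglyMeasurable
      (fun z => density ν (P.map C) (C z) * w (C z) * G z) μ :=
    ((hρ.stronglyMeasurable.mul hwm).comp_measurable hC).aestronglyMeasurable.mul hG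
  have h2 := memLp_density_mul hμ hbμ h1m h1
  refine ⟨h2.toLp _, h2.coeFn_toLp, fun f => ?_⟩
  have hf : MemLp (fun z => f z * G z) 2 P := MemLp.mul_of_ae_bound
    ((Lp.memLp f).of_measure_le_smul hbμ.ne (le_smul_of_essSup_rnDeriv hμ)) (hG.mono_ac hμ) hB
  rw [L2.inner_def, L2.inner_def]
  have e1 : ∫ x, inner ℝ (w x) (A f x) ∂ν = ∫ x, w x * condMean P C (fun z => f z * G z) x ∂ν := by
    refine integral_congr_ae ?_
    filter_upwards [hA f] with x hx
    rw [hx]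
    exact mul_comm _ _
  rw [e1, integral_mul_condMean hC hν hb hwm (Lp.memLp w) hf, ← integral_density_mul hμ]
  refine integral_congr_ae ?_
  filter_upwards [h2.coeFn_toLp] with z hz
  rw [hz]
  simp only [RCLike.inner_apply, conj_trivial]
  ring

/-- Membership of `h` is essential: inner products against `K` alone determine only the projection
of `h` onto `K`. -/
theorem eq_of_inner_eq_of_mem {T : Type*} [NormedAddCommGroup T] [InnerProductSpace ℝ T]
    {K : Submodule ℝ T} {a : K} {h : T} (hh : h ∈ K)
    (e : ∀ s : K, inner ℝ (a : T) (s : T) = inner ℝ h (s : T)) : (a : T) = h := by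
  have : a = ⟨h, hh⟩ := ext_inner_right ℝ fun s => e s
  rw [this]

theorem inner_adjoint_fst {E F W : Type*} [NormedAddCommGroup E] [InnerProductSpace ℝ E]
    [CompleteSpace E] [NormedAddCommGroup F] [InnerProductSpace ℝ F] [CompleteSpace F]
    [NormedAddCommGroup W] [InnerProductSpace ℝ W] [CompleteSpace W]
    (D : WithLp 2 (E × F) →L[ℝ] W) (w : W) (s : E) :
    inner ℝ (D.adjoint w).fst s = inner ℝ w (D (WithLp.toLp 2 (s, 0))) := by
  rw [← ContinuousLinearMap.adjoint_inner_left, WithLp.prod_inner_apply]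
  simp

theorem inner_adjoint_snd {E F W : Type*} [NormedAddCommGroup E] [InnerProductSpace ℝ E]
    [CompleteSpace E] [NormedAddCommGroup F] [InnerProductSpace ℝ F] [CompleteSpace F]
    [NormedAddCommGroup W] [InnerProductSpace ℝ W] [CompleteSpace W]
    (D : WithLp 2 (E × F) →L[ℝ] W) (w : W) (t : F) :
    inner ℝ (D.adjoint w).snd t = inner ℝ w (D (WithLp.toLp 2 (0, t))) := by
  rw [← ContinuousLinearMap.adjoint_inner_left, WithLp.prod_inner_apply]
  simp

/-- The representer of the derivative in the direction of the model belongs to the model tangent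
space. -/
theorem model_adjoint_ae_eq {M : Set (ProbabilityMeasure Z)} {P : M}
    (hP : IsLocallyNonparametric M P) [IsFiniteMeasure ν] (hC : Measurable C)
    (hν : ν ≪ P.1.toMeasure.map C)
    (hb : essSup (ν.rnDeriv (P.1.toMeasure.map C)) (P.1.toMeasure.map C) < ∞)
    (hG : AEStronglyMeasurable G P.1.toMeasure) (hB : ∀ᵐ z ∂P.1.toMeasure, |G z| ≤ B)
    (hG0 : P.1.toMeasure[G | MeasurableSpace.comap C inferInstance] =ᵐ[P.1.toMeasure] 0)
    {A : Lp ℝ 2 P.1.toMeasure →L[ℝ] Lp ℝ 2 ν}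
    (hA : ∀ f, A f =ᵐ[ν] condMean P.1.toMeasure C fun z => f z * G z) (w : Lp ℝ 2 ν)
    {a : modelTangentSpace M P}
    (ha : ∀ s : modelTangentSpace M P, inner ℝ (a : Lp ℝ 2 P.1.toMeasure) s.1 = inner ℝ w (A s.1)) :
    (a : Lp ℝ 2 P.1.toMeasure) =ᵐ[P.1.toMeasure] fun z =>
      density ν (P.1.toMeasure.map C) (C z) * w (C z) * G z := by
  obtain ⟨h, h1, h2⟩ := exists_adjoint_condMean_clm hC Measure.AbsolutelyContinuous.rfl
    essSup_rnDeriv_self_lt_top hν hb hG hB hA w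
  have h3 : h =ᵐ[P.1.toMeasure] fun z =>
      density ν (P.1.toMeasure.map C) (C z) * w (C z) * G z := by
    filter_upwards [h1, Measure.rnDeriv_self P.1.toMeasure] with z h1 h2
    rw [h1]
    simp only [density, h2, ENNReal.toReal_one, one_mul]
  have hmem : h ∈ modelTangentSpace M P := by
    rw [hP]
    -- Mean zero is the adjoint identity read backwards: the integral equals that of `w` times the
    -- conditional mean of `G`, which vanishes.
    rw [integral_congr_ae h3, ← integral_mul_condMean hC hν hb (Lp.stronglyMeasurable w)
      (Lp.memLp w) (MemLp.of_bound hG B hB)]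
    refine integral_eq_zero_of_ae ?_
    have h4 : condMean P.1.toMeasure C G =ᵐ[P.1.toMeasure.map C] 0 := by
      refine ae_map_of_comp_ae_eq hC (condMean_stronglyMeasurable _ _ _) stronglyMeasurable_zero ?_
      rw [← condMean_comp]
      exact hG0
    filter_upwards [hν.ae_le h4] with x hx
    rw [hx]
    simp
  rw [eq_of_inner_eq_of_mem hmem fun s => (ha s).trans (h2 s.1).symm]
  exact h3

end Adjoint

/-! ### The derivative of the conditional covariance in `L²` of the law of `X` -/

section Derivative

variable {Z X : Type*} [MeasurableSpace Z] [MeasurableSpace X] {C : Z → X}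

/-- The function `f` centered at its conditional mean. -/
def condCentered (P : Measure Z) (C : Z → X) (f : Z → ℝ) (z : Z) : ℝ := f z - condMean P C f (C z)

/-- The product of the conditionally centered functions, centered at the conditional covariance. -/
def condCovResidual (P : Measure Z) (C : Z → X) (f g : Z → ℝ) (z : Z) : ℝ :=
  condCentered P C f z * condCentered P C g z - condCov P C f g (C z)

variable {P Q : Measure Z} {f g : Z → ℝ} {K : ℝ}

theorem condCentered_eq (P : Measure Z) (C : Z → X) (f : Z → ℝ) :
    condCentered P C f = f - P[f | MeasurableSpace.comap C inferInstance] := by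
  rw [condMean_comp]
  rfl

theorem condCov_comp (P : Measure Z) (C : Z → X) (f g : Z → ℝ) : condCov P C f g ∘ C =
    P[fun z => (f z - (P[f | MeasurableSpace.comap C inferInstance]) z) *
      (g z - (P[g | MeasurableSpace.comap C inferInstance]) z) |
        MeasurableSpace.comap C inferInstance] := by
  rw [condMean_comp, condMean_comp, condMean_comp]
  rfl

theorem condCovResidual_eq (P : Measure Z) (C : Z → X) (f g : Z → ℝ) :
    condCovResidual P C f g = (fun z => condCentered P C f z * condCentered P C g z)
      - P[fun z => condCentered P C f z * condCentered P C g z |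
        MeasurableSpace.comap C inferInstance] := by
  rw [condMean_comp]
  rfl

theorem aestronglyMeasurable_condCentered (hC : Measurable C) (hf : AEStronglyMeasurable f Q) :
    AEStronglyMeasurable (condCentered P C f) Q :=
  hf.sub ((condMean_stronglyMeasurable P C f).comp_measurable hC).aestronglyMeasurable

theorem aestronglyMeasurable_condCovResidual (hC : Measurable C) (hf : AEStronglyMeasurable f Q)
    (hg : AEStronglyMeasurable g Q) : AEStronglyMeasurable (condCovResidual P C f g) Q :=
  ((aestronglyMeasurable_condCentered hC hf).mul (aestronglyMeasurable_condCentered hC hg)).sub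
    ((condMean_stronglyMeasurable P C _).comp_measurable hC).aestronglyMeasurable

theorem ae_bound_condCentered (hf : ∀ᵐ z ∂P, |f z| ≤ K) :
    ∀ᵐ z ∂P, |condCentered P C f z| ≤ K + K := by
  rw [condCentered_eq]
  exact ae_bound_sub_condExp hf

theorem ae_bound_condCovResidual (hf : ∀ᵐ z ∂P, |f z| ≤ K) (hg : ∀ᵐ z ∂P, |g z| ≤ K) :
    ∀ᵐ z ∂P, |condCovResidual P C f g z| ≤ (K + K) * (K + K) + (K + K) * (K + K) := by
  rw [condCovResidual_eq]
  exact ae_bound_sub_condExp (ae_bound_mul (ae_bound_condCentered hf) (ae_bound_condCentered hg))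

theorem condExp_condCovResidual [IsFiniteMeasure P] (hC : Measurable C)
    (hfm : AEStronglyMeasurable f P) (hgm : AEStronglyMeasurable g P)
    (hf : ∀ᵐ z ∂P, |f z| ≤ K) (hg : ∀ᵐ z ∂P, |g z| ≤ K) :
    P[condCovResidual P C f g | MeasurableSpace.comap C inferInstance] =ᵐ[P] 0 := by
  rw [condCovResidual_eq]
  exact condExp_sub_condExp hC.comap_le (Integrable.of_ae_bound
    ((aestronglyMeasurable_condCentered hC hfm).mul (aestronglyMeasurable_condCentered hC hgm))
    (ae_bound_mul (ae_bound_condCentered hf) (ae_bound_condCentered hg)))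

theorem condCentered_ae_eq_zero (hf : f =ᵐ[P] 0) :
    condCentered P C f =ᵐ[P] 0 := by
  rw [condCentered_eq]
  have h := condExp_congr_ae (m := MeasurableSpace.comap C inferInstance) hf
  rw [condExp_zero] at h
  filter_upwards [hf, h] with z h1 h2
  rw [Pi.sub_apply, h1, h2]
  simp

/-- The difference quotients of the conditional covariance along a quadratic mean differentiable
submodel and smooth paths of bounded functions converge in `L²` of the law of `X`. -/
theorem tendstoL2_condCov_quotient {M : Set (ProbabilityMeasure Z)} (hM : AllEquivalent M)
    {P Q : M} (hC : Measurable C)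
    (hQP : essSup ((Q.1.toMeasure.map C).rnDeriv (P.1.toMeasure.map C)) (P.1.toMeasure.map C) < ∞)
    (hPQ : essSup (P.1.toMeasure.rnDeriv Q.1.toMeasure) Q.1.toMeasure < ∞)
    {s : Lp ℝ 2 P.1.toMeasure} {γ : I → M} (hγ : IsQMDPath M P s γ) {m : ℝ}
    {u₁ u₂ : I → Lp ℝ 2 Q.1.toMeasure} {v₁ v₂ t₁ t₂ : Lp ℝ 2 Q.1.toMeasure}
    (hu₁ : ∀ ε, u₁ ε ∈ boundedFunctions Q.1.toMeasure m)
    (hu₂ : ∀ ε, u₂ ε ∈ boundedFunctions Q.1.toMeasure m)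
    (hv₁ : v₁ ∈ boundedFunctions Q.1.toMeasure m) (hv₂ : v₂ ∈ boundedFunctions Q.1.toMeasure m)
    (h₁ : (fun ε : I => ‖u₁ ε - v₁ - (ε : ℝ) • t₁‖) =o[𝓝[>] (0 : I)] fun ε : I => (ε : ℝ))
    (h₂ : (fun ε : I => ‖u₂ ε - v₂ - (ε : ℝ) • t₂‖) =o[𝓝[>] (0 : I)] fun ε : I => (ε : ℝ)) :
    TendstoL2 (Q.1.toMeasure.map C) (𝓝[>] (0 : I)) (fun ε x =>
      (condCov (γ ε).1.toMeasure C (u₁ ε) (u₂ ε) x - condCov P.1.toMeasure C v₁ v₂ x) / (ε : ℝ))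
      (condMean P.1.toMeasure C (fun z => s z * condCovResidual P.1.toMeasure C v₁ v₂ z) +
        (condMean P.1.toMeasure C (fun z => t₁ z * condCentered P.1.toMeasure C v₂ z) +
          condMean P.1.toMeasure C (fun z => t₂ z * condCentered P.1.toMeasure C v₁ z))) := by
  have hac : P.1.toMeasure ≪ Q.1.toMeasure := hM _ P.2 _ Q.2
  have hν : Q.1.toMeasure.map C ≪ P.1.toMeasure.map C := Measure.AbsolutelyContinuous.map
    (hM _ Q.2 _ P.2) hC
  have hle := le_smul_of_essSup_rnDeriv hac
  have hm : ∀ f : Lp ℝ 2 Q.1.toMeasure, AEStronglyMeasurable f P.1.toMeasure := fun f =>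
    (Lp.aestronglyMeasurable f).mono_ac hac
  have key := tendstoL2_condCov hC.comap_le (P := P.1.toMeasure) (l := 𝓝[>] (0 : I))
    (Pε := fun ε => (γ ε).1.toMeasure) (fun ε => hM _ (γ ε).2 _ P.2) (fun ε => hM _ P.2 _ (γ ε).2)
    tendsto_coe_unitInterval eventually_pos_unitInterval hγ.tendstoL2
    (fun ε => hm (u₁ ε)) (fun ε => hm (u₂ ε)) (hm v₁) (hm v₂)
    (fun ε => hac.ae_le (hu₁ ε)) (fun ε => hac.ae_le (hu₂ ε)) (hac.ae_le hv₁) (hac.ae_le hv₂)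
    (((isLittleO_iff_tendstoL2 eventually_pos_unitInterval).1 h₁).of_measure_le_smul hPQ.ne hle)
    (((isLittleO_iff_tendstoL2 eventually_pos_unitInterval).1 h₂).of_measure_le_smul hPQ.ne hle)
    (condCentered_eq _ C _) (condCentered_eq _ C _) (condCovResidual_eq _ C _ _)
  simp only [← condCov_comp] at key
  rw [condMean_comp, condMean_comp, condMean_comp] at key
  have cm : ∀ (R : Measure Z) (f : Z → ℝ), StronglyMeasurable (condMean R C f) := fun R f =>
    condMean_stronglyMeasurable R C f
  -- All functions factor through `C`, so convergence under `P` is convergence under the law of `X`;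
  -- the bound on `dQ_X/dP_X` then carries it to `Q_X`.
  refine ((TendstoL2.map_iff hC (fun ε => ?_) ?_).2 key).of_measure_le_smul hQP.ne
    (le_smul_of_essSup_rnDeriv hν)
  · simp only [div_eq_mul_inv]
    exact (((cm _ _).sub (cm _ _)).mul_const _).aestronglyMeasurable
  · exact ((cm _ _).add ((cm _ _).add (cm _ _))).aestronglyMeasurable

end Derivative

/-! ### The two primitives -/

section Primitives

variable {Z X : Type*} [MeasurableSpace Z] [MeasurableSpace X] {C : Z → X}
  {M : Set (ProbabilityMeasure Z)} {P Q : M} {m : ℝ}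

/-- A representer that is a conditionally centered multiple of an element of a ball of `L^∞(Q)` of
radius zero vanishes. -/
theorem representer_eq_zero {P Q : Measure Z} (hPQ : P ≪ Q) (hQP : Q ≪ P) (hm : m ≤ 0)
    {v h : Lp ℝ 2 Q} {k : Z → ℝ} (hv : v ∈ boundedFunctions Q m)
    (hh : h =ᵐ[Q] fun z => k z * condCentered P C v z) : h = 0 := by
  have h0 : (v : Z → ℝ) =ᵐ[P] 0 := by
    filter_upwards [hPQ.ae_le hv] with z hz
    exact abs_eq_zero.1 (le_antisymm (hz.trans hm) (abs_nonneg _))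
  ext1
  filter_upwards [hh, hQP.ae_le (condCentered_ae_eq_zero (C := C) h0), Lp.coeFn_zero ℝ 2 Q]
    with z h1 h2 h3
  rw [h1, h2, h3]
  simp

theorem exists_condCov_clms (hM : AllEquivalent M) (hC : Measurable C)
    (hQP : essSup ((Q.1.toMeasure.map C).rnDeriv (P.1.toMeasure.map C)) (P.1.toMeasure.map C) < ∞)
    (hPQ : essSup (P.1.toMeasure.rnDeriv Q.1.toMeasure) Q.1.toMeasure < ∞)
    {v₁ v₂ : Lp ℝ 2 Q.1.toMeasure} (hv₁ : v₁ ∈ boundedFunctions Q.1.toMeasure m)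
    (hv₂ : v₂ ∈ boundedFunctions Q.1.toMeasure m) :
    ∃ (A : Lp ℝ 2 P.1.toMeasure →L[ℝ] Lp ℝ 2 (Q.1.toMeasure.map C))
      (A₁ A₂ : Lp ℝ 2 Q.1.toMeasure →L[ℝ] Lp ℝ 2 (Q.1.toMeasure.map C)),
      (∀ s, A s =ᵐ[Q.1.toMeasure.map C]
        condMean P.1.toMeasure C fun z => s z * condCovResidual P.1.toMeasure C v₁ v₂ z) ∧
      (∀ t, A₁ t =ᵐ[Q.1.toMeasure.map C]
        condMean P.1.toMeasure C fun z => t z * condCentered P.1.toMeasure C v₂ z) ∧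
      ∀ t, A₂ t =ᵐ[Q.1.toMeasure.map C]
        condMean P.1.toMeasure C fun z => t z * condCentered P.1.toMeasure C v₁ z := by
  have hac : P.1.toMeasure ≪ Q.1.toMeasure := hM _ P.2 _ Q.2
  have hν := le_smul_of_essSup_rnDeriv
    (Measure.AbsolutelyContinuous.map (hM _ Q.2 _ P.2) hC :
      Q.1.toMeasure.map C ≪ P.1.toMeasure.map C)
  have hle := le_smul_of_essSup_rnDeriv hac
  have hm : ∀ f : Lp ℝ 2 Q.1.toMeasure, AEStronglyMeasurable f P.1.toMeasure := fun f =>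
    (Lp.aestronglyMeasurable f).mono_ac hac
  obtain ⟨A, hA⟩ := exists_condMean_clm (μ := P.1.toMeasure) hC ENNReal.one_ne_top
    (by rw [one_smul]) hQP.ne hν
    (aestronglyMeasurable_condCovResidual (P := P.1.toMeasure) hC (hm v₁) (hm v₂))
    (ae_bound_condCovResidual (hac.ae_le hv₁) (hac.ae_le hv₂))
  obtain ⟨A₁, hA₁⟩ := exists_condMean_clm hC hPQ.ne hle hQP.ne hν
    (aestronglyMeasurable_condCentered (P := P.1.toMeasure) hC (hm v₂))
    (ae_bound_condCentered (hac.ae_le hv₂))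
  obtain ⟨A₂, hA₂⟩ := exists_condMean_clm hC hPQ.ne hle hQP.ne hν
    (aestronglyMeasurable_condCentered (P := P.1.toMeasure) hC (hm v₁))
    (ae_bound_condCentered (hac.ae_le hv₁))
  exact ⟨A, A₁, A₂, hA, hA₁, hA₂⟩

theorem exists_hasTotalPathwiseDeriv_condCovMap (hM : AllEquivalent M) (hC : Measurable C)
    (hQP : essSup ((Q.1.toMeasure.map C).rnDeriv (P.1.toMeasure.map C)) (P.1.toMeasure.map C) < ∞)
    (hPQ : essSup (P.1.toMeasure.rnDeriv Q.1.toMeasure) Q.1.toMeasure < ∞)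
    (u : boundedPairs Q.1.toMeasure m)
    {A : Lp ℝ 2 P.1.toMeasure →L[ℝ] Lp ℝ 2 (Q.1.toMeasure.map C)}
    {A₁ A₂ : Lp ℝ 2 Q.1.toMeasure →L[ℝ] Lp ℝ 2 (Q.1.toMeasure.map C)}
    (hA : ∀ s, A s =ᵐ[Q.1.toMeasure.map C] condMean P.1.toMeasure C fun z =>
      s z * condCovResidual P.1.toMeasure C (u.1 0) (u.1 1) z)
    (hA₁ : ∀ t, A₁ t =ᵐ[Q.1.toMeasure.map C]
      condMean P.1.toMeasure C fun z => t z * condCentered P.1.toMeasure C (u.1 1) z)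
    (hA₂ : ∀ t, A₂ t =ᵐ[Q.1.toMeasure.map C]
      condMean P.1.toMeasure C fun z => t z * condCentered P.1.toMeasure C (u.1 0) z) :
    ∃ D, HasTotalPathwiseDeriv (condCovMap hM Q hC m) P u D ∧
      ∀ s t, D (WithLp.toLp 2 (s, t)) = A s.1 + (A₁ (t.1 0) + A₂ (t.1 1)) := by
  refine ⟨A ∘L (modelTangentSpace M P).subtypeL ∘L WithLp.fstL 2 ℝ _ _ +
    (A₁ ∘L PiLp.proj 2 (fun _ : Fin 2 => Lp ℝ 2 Q.1.toMeasure) 0 +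
      A₂ ∘L PiLp.proj 2 (fun _ : Fin 2 => Lp ℝ 2 Q.1.toMeasure) 1) ∘L
    (tangentSpace (boundedPairs Q.1.toMeasure m) u.1).subtypeL ∘L WithLp.sndL 2 ℝ _ _,
    fun s t Pε uε hP hu => ?_, fun _ _ => rfl⟩
  have hj : ∀ j : Fin 2, (fun ε : I => ‖(uε ε).1 j - u.1 j - (ε : ℝ) • t.1 j‖)
      =o[𝓝[>] (0 : I)] fun ε : I => (ε : ℝ) := fun j => by
    refine IsBigO.trans_isLittleO (IsBigO.of_bound 1 (Eventually.of_forall fun ε => ?_)) hu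
    rw [norm_norm, norm_norm, one_mul]
    exact PiLp.norm_apply_le ((uε ε).1 - u.1 - (ε : ℝ) • t.1) j
  rw [isLittleO_iff_tendstoL2 eventually_pos_unitInterval]
  refine (tendstoL2_condCov_quotient hM hC hQP hPQ hP (fun ε => (uε ε).2 0) (fun ε => (uε ε).2 1)
    (u.2 0) (u.2 1) (hj 0) (hj 1)).congr (fun ε => ?_) (Eventually.of_forall fun ε => ?_) ?_
  · simp only [div_eq_mul_inv]
    exact ((Lp.memLp _).sub (Lp.memLp _)).mul_const _
  · filter_upwards [MemLp.coeFn_toLp (condCov_memLp (P := (Pε ε).1.toMeasure)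
      (hM _ Q.2 _ (Pε ε).2) hC ((hM _ (Pε ε).2 _ Q.2).ae_le ((uε ε).2 0))
      ((hM _ (Pε ε).2 _ Q.2).ae_le ((uε ε).2 1))),
      MemLp.coeFn_toLp (condCov_memLp (P := P.1.toMeasure) (hM _ Q.2 _ P.2) hC
        ((hM _ P.2 _ Q.2).ae_le (u.2 0)) ((hM _ P.2 _ Q.2).ae_le (u.2 1)))] with x h1 h2
    rw [condCovMap, condCovMap, h1, h2]
  · symm
    refine (Lp.coeFn_add _ _).trans ((hA s.1).add ?_)
    exact (Lp.coeFn_add _ _).trans ((hA₁ (t.1 0)).add (hA₂ (t.1 1)))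

/-- The variance is the covariance along two equal paths; the product rule then yields the same term
twice. -/
theorem exists_hasTotalPathwiseDeriv_condVarianceMap (hM : AllEquivalent M) (hC : Measurable C)
    (hQP : essSup ((Q.1.toMeasure.map C).rnDeriv (P.1.toMeasure.map C)) (P.1.toMeasure.map C) < ∞)
    (hPQ : essSup (P.1.toMeasure.rnDeriv Q.1.toMeasure) Q.1.toMeasure < ∞)
    (u : boundedFunctions Q.1.toMeasure m)
    {A : Lp ℝ 2 P.1.toMeasure →L[ℝ] Lp ℝ 2 (Q.1.toMeasure.map C)}
    {A₁ : Lp ℝ 2 Q.1.toMeasure →L[ℝ] Lp ℝ 2 (Q.1.toMeasure.map C)}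
    (hA : ∀ s, A s =ᵐ[Q.1.toMeasure.map C] condMean P.1.toMeasure C fun z =>
      s z * condCovResidual P.1.toMeasure C u.1 u.1 z)
    (hA₁ : ∀ t, A₁ t =ᵐ[Q.1.toMeasure.map C]
      condMean P.1.toMeasure C fun z => t z * condCentered P.1.toMeasure C u.1 z) :
    ∃ D, HasTotalPathwiseDeriv (condVarianceMap hM Q hC m) P u D ∧
      ∀ s t, D (WithLp.toLp 2 (s, t)) = A s.1 + (A₁ t.1 + A₁ t.1) := by
  refine ⟨A ∘L (modelTangentSpace M P).subtypeL ∘L WithLp.fstL 2 ℝ _ _ + (A₁ + A₁) ∘L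
    (tangentSpace (boundedFunctions Q.1.toMeasure m) u.1).subtypeL ∘L WithLp.sndL 2 ℝ _ _,
    fun s t Pε uε hP hu => ?_, fun _ _ => rfl⟩
  rw [isLittleO_iff_tendstoL2 eventually_pos_unitInterval]
  refine (tendstoL2_condCov_quotient hM hC hQP hPQ hP (fun ε => (uε ε).2) (fun ε => (uε ε).2)
    u.2 u.2 hu hu).congr (fun ε => ?_) (Eventually.of_forall fun ε => ?_) ?_
  · simp only [div_eq_mul_inv]
    exact ((Lp.memLp _).sub (Lp.memLp _)).mul_const _
  · filter_upwards [MemLp.coeFn_toLp (condVariance_memLp (P := (Pε ε).1.toMeasure)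
      (hM _ Q.2 _ (Pε ε).2) hC ((hM _ (Pε ε).2 _ Q.2).ae_le (uε ε).2)),
      MemLp.coeFn_toLp (condVariance_memLp (P := P.1.toMeasure) (hM _ Q.2 _ P.2) hC
        ((hM _ P.2 _ Q.2).ae_le u.2))] with x h1 h2
    rw [condVarianceMap, condVarianceMap, h1, h2]
    simp only [condCov, condVariance, sq]
  · symm
    refine (Lp.coeFn_add _ _).trans ((hA s.1).add ?_)
    exact (Lp.coeFn_add _ _).trans ((hA₁ t.1).add (hA₁ t.1))

theorem adjoint_condCovMap (hM : AllEquivalent M) (hC : Measurable C)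
    (hP : IsLocallyNonparametric M P)
    (hQP : essSup ((Q.1.toMeasure.map C).rnDeriv (P.1.toMeasure.map C)) (P.1.toMeasure.map C) < ∞)
    (hPQ : essSup (P.1.toMeasure.rnDeriv Q.1.toMeasure) Q.1.toMeasure < ∞)
    (u : boundedPairs Q.1.toMeasure m)
    {A : Lp ℝ 2 P.1.toMeasure →L[ℝ] Lp ℝ 2 (Q.1.toMeasure.map C)}
    {A₁ A₂ : Lp ℝ 2 Q.1.toMeasure →L[ℝ] Lp ℝ 2 (Q.1.toMeasure.map C)}
    (hA : ∀ s, A s =ᵐ[Q.1.toMeasure.map C] condMean P.1.toMeasure C fun z =>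
      s z * condCovResidual P.1.toMeasure C (u.1 0) (u.1 1) z)
    (hA₁ : ∀ t, A₁ t =ᵐ[Q.1.toMeasure.map C]
      condMean P.1.toMeasure C fun z => t z * condCentered P.1.toMeasure C (u.1 1) z)
    (hA₂ : ∀ t, A₂ t =ᵐ[Q.1.toMeasure.map C]
      condMean P.1.toMeasure C fun z => t z * condCentered P.1.toMeasure C (u.1 0) z)
    {D : WithLp 2 (modelTangentSpace M P × tangentSpace (boundedPairs Q.1.toMeasure m) u.1)
      →L[ℝ] Lp ℝ 2 (Q.1.toMeasure.map C)}
    (hD : ∀ s t, D (WithLp.toLp 2 (s, t)) = A s.1 + (A₁ (t.1 0) + A₂ (t.1 1)))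
    (w : Lp ℝ 2 (Q.1.toMeasure.map C)) :
    ((D.adjoint w).fst.1 =ᵐ[P.1.toMeasure] fun z =>
      density (Q.1.toMeasure.map C) (P.1.toMeasure.map C) (C z) * w (C z) *
        condCovResidual P.1.toMeasure C (u.1 0) (u.1 1) z) ∧
    ∀ j : Fin 2, (D.adjoint w).snd.1 j =ᵐ[Q.1.toMeasure] fun z =>
      density P.1.toMeasure Q.1.toMeasure z *
        (density (Q.1.toMeasure.map C) (P.1.toMeasure.map C) (C z) * w (C z) *
        condCentered P.1.toMeasure C (u.1 (Fin.rev j)) z) := by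
  have hac : P.1.toMeasure ≪ Q.1.toMeasure := hM _ P.2 _ Q.2
  have hν : Q.1.toMeasure.map C ≪ P.1.toMeasure.map C :=
    Measure.AbsolutelyContinuous.map (hM _ Q.2 _ P.2) hC
  have hmQ : ∀ f : Lp ℝ 2 Q.1.toMeasure, AEStronglyMeasurable f Q.1.toMeasure :=
    Lp.aestronglyMeasurable
  have hm : ∀ f : Lp ℝ 2 Q.1.toMeasure, AEStronglyMeasurable f P.1.toMeasure := fun f =>
    (hmQ f).mono_ac hac
  have hbP : ∀ j, ∀ᵐ z ∂P.1.toMeasure, |u.1 j z| ≤ m := fun j => hac.ae_le (u.2 j)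
  refine ⟨model_adjoint_ae_eq hP hC hν hQP (aestronglyMeasurable_condCovResidual hC (hm (u.1 0)) (hm (u.1 1)))
    (ae_bound_condCovResidual (hbP 0) (hbP 1))
    (condExp_condCovResidual hC (hm (u.1 0)) (hm (u.1 1)) (hbP 0) (hbP 1)) hA w
    fun s => ?_, ?_⟩
  · refine (inner_adjoint_fst D w s).trans ?_
    rw [hD]
    simp
  refine Exists.elim (exists_adjoint_condMean_clm hC hac hPQ hν hQP
    (aestronglyMeasurable_condCentered hC (hmQ (u.1 1))) (ae_bound_condCentered (hbP 1)) hA₁ w)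
    fun h₁ hh₁ => ?_
  refine Exists.elim (exists_adjoint_condMean_clm hC hac hPQ hν hQP
    (aestronglyMeasurable_condCentered hC (hmQ (u.1 0))) (ae_bound_condCentered (hbP 0)) hA₂ w)
    fun h₂ hh₂ => ?_
  have e₁ := hh₁.1
  have e₂ := hh₂.1
  have hmem : (WithLp.toLp 2 ![h₁, h₂] : PiLp 2 fun _ : Fin 2 => Lp ℝ 2 Q.1.toMeasure) ∈
      tangentSpace (boundedPairs Q.1.toMeasure m) u.1 := by
    -- For `m ≤ 0` the tangent space need not be everything, but `u` vanishes almost everywhere and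
    -- so do the representers.
    rcases lt_or_ge 0 m with hm0 | hm0
    · rw [tangentSpace_boundedPairs hm0]
      exact Submodule.mem_top
    · simp only [← mul_assoc] at e₁ e₂
      rw [representer_eq_zero hac (hM _ Q.2 _ P.2) hm0 (v := u.1 1) (u.2 1) e₁,
        representer_eq_zero hac (hM _ Q.2 _ P.2) hm0 (v := u.1 0) (u.2 0) e₂]
      have h0 : (WithLp.toLp 2 ![0, 0] : PiLp 2 fun _ : Fin 2 => Lp ℝ 2 Q.1.toMeasure) = 0 := by
        ext1 j
        fin_cases j <;> rfl
      rw [h0]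
      exact Submodule.zero_mem _
  have hsnd : (D.adjoint w).snd.1 = WithLp.toLp 2 ![h₁, h₂] :=
    eq_of_inner_eq_of_mem hmem fun t => by
      refine (inner_adjoint_snd D w t).trans ?_
      rw [hD, PiLp.inner_apply, Fin.sum_univ_two]
      simp [inner_add_right, hh₁.2, hh₂.2]
  rw [hsnd]
  intro j
  fin_cases j
  · exact hh₁.1
  · exact hh₂.1

theorem adjoint_condVarianceMap (hM : AllEquivalent M) (hC : Measurable C)
    (hP : IsLocallyNonparametric M P)
    (hQP : essSup ((Q.1.toMeasure.map C).rnDeriv (P.1.toMeasure.map C)) (P.1.toMeasure.map C) < ∞)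
    (hPQ : essSup (P.1.toMeasure.rnDeriv Q.1.toMeasure) Q.1.toMeasure < ∞)
    (u : boundedFunctions Q.1.toMeasure m)
    {A : Lp ℝ 2 P.1.toMeasure →L[ℝ] Lp ℝ 2 (Q.1.toMeasure.map C)}
    {A₁ : Lp ℝ 2 Q.1.toMeasure →L[ℝ] Lp ℝ 2 (Q.1.toMeasure.map C)}
    (hA : ∀ s, A s =ᵐ[Q.1.toMeasure.map C] condMean P.1.toMeasure C fun z =>
      s z * condCovResidual P.1.toMeasure C u.1 u.1 z)
    (hA₁ : ∀ t, A₁ t =ᵐ[Q.1.toMeasure.map C]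
      condMean P.1.toMeasure C fun z => t z * condCentered P.1.toMeasure C u.1 z)
    {D : WithLp 2 (modelTangentSpace M P × tangentSpace (boundedFunctions Q.1.toMeasure m) u.1)
      →L[ℝ] Lp ℝ 2 (Q.1.toMeasure.map C)}
    (hD : ∀ s t, D (WithLp.toLp 2 (s, t)) = A s.1 + (A₁ t.1 + A₁ t.1))
    (w : Lp ℝ 2 (Q.1.toMeasure.map C)) :
    ((D.adjoint w).fst.1 =ᵐ[P.1.toMeasure] fun z =>
      density (Q.1.toMeasure.map C) (P.1.toMeasure.map C) (C z) * w (C z) *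
        condCovResidual P.1.toMeasure C u.1 u.1 z) ∧
    (D.adjoint w).snd.1 =ᵐ[Q.1.toMeasure] fun z =>
      2 * (density P.1.toMeasure Q.1.toMeasure z *
        (density (Q.1.toMeasure.map C) (P.1.toMeasure.map C) (C z) * w (C z) *
        condCentered P.1.toMeasure C u.1 z)) := by
  have hac : P.1.toMeasure ≪ Q.1.toMeasure := hM _ P.2 _ Q.2
  have hν : Q.1.toMeasure.map C ≪ P.1.toMeasure.map C :=
    Measure.AbsolutelyContinuous.map (hM _ Q.2 _ P.2) hC
  have hmQ : ∀ f : Lp ℝ 2 Q.1.toMeasure, AEStronglyMeasurable f Q.1.toMeasure :=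
    Lp.aestronglyMeasurable
  have hm : ∀ f : Lp ℝ 2 Q.1.toMeasure, AEStronglyMeasurable f P.1.toMeasure := fun f =>
    (hmQ f).mono_ac hac
  have hbP : ∀ᵐ z ∂P.1.toMeasure, |u.1 z| ≤ m := hac.ae_le u.2
  refine ⟨model_adjoint_ae_eq hP hC hν hQP (aestronglyMeasurable_condCovResidual hC (hm u.1) (hm u.1))
    (ae_bound_condCovResidual hbP hbP)
    (condExp_condCovResidual hC (hm u.1) (hm u.1) hbP hbP) hA w
    fun s => ?_, ?_⟩
  · refine (inner_adjoint_fst D w s).trans ?_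
    rw [hD]
    simp
  refine Exists.elim (exists_adjoint_condMean_clm hC hac hPQ hν hQP
    (aestronglyMeasurable_condCentered hC (hmQ u.1)) (ae_bound_condCentered hbP) hA₁ w)
    fun h₁ hh₁ => ?_
  have e₁ := hh₁.1
  have hmem : (2 : ℝ) • h₁ ∈ tangentSpace (boundedFunctions Q.1.toMeasure m) u.1 := by
    rcases lt_or_ge 0 m with hm0 | hm0
    · rw [tangentSpace_boundedFunctions hm0]
      exact Submodule.mem_top
    · simp only [← mul_assoc] at e₁
      rw [representer_eq_zero hac (hM _ Q.2 _ P.2) hm0 u.2 e₁, smul_zero]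
      exact Submodule.zero_mem _
  have hsnd : (D.adjoint w).snd.1 = (2 : ℝ) • h₁ :=
    eq_of_inner_eq_of_mem hmem fun t => by
      refine (inner_adjoint_snd D w t).trans ?_
      rw [hD, real_inner_smul_left, hh₁.2]
      simp [inner_add_right, two_mul]
  rw [hsnd]
  filter_upwards [Lp.coeFn_smul (2 : ℝ) h₁, hh₁.1] with z h1 h2
  rw [h1, Pi.smul_apply, h2, smul_eq_mul]

end Primitives

end

/-! ### The gradient formulas for the conditional covariance and variance. -/

theorem lemmaS9 {Z X : Type*} [MeasurableSpace Z] [MeasurableSpace X]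
    (C : Z → X) (hC : Measurable C)
    (M : Set (ProbabilityMeasure Z)) (hM : AllEquivalent M) (P Q : M)
    (hP : IsLocallyNonparametric M P) (m : ℝ)
    -- `dQ_X/dP_X` is `P_X`-essentially bounded and `dP/dQ` is `Q`-essentially bounded
    (hQP : essSup ((Q.1.toMeasure.map C).rnDeriv (P.1.toMeasure.map C)) (P.1.toMeasure.map C) < ∞)
    (hPQ : essSup (P.1.toMeasure.rnDeriv Q.1.toMeasure) Q.1.toMeasure < ∞) :
    -- conditional covariance
    (∀ u : boundedPairs Q.1.toMeasure m,
      TotallyPathwiseDifferentiableAt (condCovMap hM Q hC m) P u ∧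
      ∀ D : WithLp 2 (modelTangentSpace M P × tangentSpace (boundedPairs Q.1.toMeasure m) u.1)
          →L[ℝ] Lp ℝ 2 (Q.1.toMeasure.map C),
        HasTotalPathwiseDeriv (condCovMap hM Q hC m) P u D →
        ∀ w : Lp ℝ 2 (Q.1.toMeasure.map C),
          ((D.adjoint w).fst.1 =ᵐ[P.1.toMeasure] fun z =>
            density (Q.1.toMeasure.map C) (P.1.toMeasure.map C) (C z) * w (C z) *
              (∏ j, (u.1 j z - condMean P.1.toMeasure C (u.1 j) (C z))
                - condCov P.1.toMeasure C (u.1 0) (u.1 1) (C z))) ∧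
          ∀ j : Fin 2, (D.adjoint w).snd.1 j =ᵐ[Q.1.toMeasure] fun z =>
            density P.1.toMeasure Q.1.toMeasure z *
              density (Q.1.toMeasure.map C) (P.1.toMeasure.map C) (C z) * w (C z) *
              (u.1 (Fin.rev j) z - condMean P.1.toMeasure C (u.1 (Fin.rev j)) (C z))) ∧
    -- conditional variance
    (∀ u : boundedFunctions Q.1.toMeasure m,
      TotallyPathwiseDifferentiableAt (condVarianceMap hM Q hC m) P u ∧
      ∀ D : WithLp 2 (modelTangentSpace M P × tangentSpace (boundedFunctions Q.1.toMeasure m) u.1)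
          →L[ℝ] Lp ℝ 2 (Q.1.toMeasure.map C),
        HasTotalPathwiseDeriv (condVarianceMap hM Q hC m) P u D →
        ∀ w : Lp ℝ 2 (Q.1.toMeasure.map C),
          ((D.adjoint w).fst.1 =ᵐ[P.1.toMeasure] fun z =>
            density (Q.1.toMeasure.map C) (P.1.toMeasure.map C) (C z) * w (C z) *
              ((u.1 z - condMean P.1.toMeasure C u.1 (C z)) ^ 2
                - condVariance P.1.toMeasure C u.1 (C z))) ∧
          (D.adjoint w).snd.1 =ᵐ[Q.1.toMeasure] fun z =>
            2 * density P.1.toMeasure Q.1.toMeasure z *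
              density (Q.1.toMeasure.map C) (P.1.toMeasure.map C) (C z) * w (C z) *
              (u.1 z - condMean P.1.toMeasure C u.1 (C z))) := by
  refine ⟨fun u => ?_, fun u => ?_⟩
  · refine Exists.elim (exists_condCov_clms hM hC hQP hPQ (v₁ := u.1 0) (v₂ := u.1 1)
      (u.2 0) (u.2 1)) fun A h => Exists.elim h fun A₁ h => Exists.elim h fun A₂ h => ?_
    refine Exists.elim (exists_hasTotalPathwiseDeriv_condCovMap hM hC hQP hPQ u h.1 h.2.1 h.2.2)
      fun D₀ hD₀ => ⟨⟨D₀, hD₀.1⟩, fun D hD w => ?_⟩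
    have key := adjoint_condCovMap hM hC hP hQP hPQ u h.1 h.2.1 h.2.2 (D := D)
      -- Uniqueness identifies the given `D` with the constructed `D₀`, whose values are known.
      (by rw [hD.unique hD₀.1]; exact hD₀.2) w
    refine ⟨?_, fun j => ?_⟩
    · filter_upwards [key.1] with z hz
      rw [hz, Fin.prod_univ_two]
      rfl
    · filter_upwards [key.2 j] with z hz
      rw [hz, condCentered]
      ring
  · refine Exists.elim (exists_condCov_clms hM hC hQP hPQ u.2 u.2)
      fun A h => Exists.elim h fun A₁ h => Exists.elim h fun A₂ h => ?_
    refine Exists.elim (exists_hasTotalPathwiseDeriv_condVarianceMap hM hC hQP hPQ u h.1 h.2.1)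
      fun D₀ hD₀ => ⟨⟨D₀, hD₀.1⟩, fun D hD w => ?_⟩
    have key := adjoint_condVarianceMap hM hC hP hQP hPQ u h.1 h.2.1 (D := D)
      (by rw [hD.unique hD₀.1]; exact hD₀.2) w
    refine ⟨?_, ?_⟩
    · filter_upwards [key.1] with z hz
      simp only [hz, condCovResidual, condCov, condVariance, condCentered, sq]
    · filter_upwards [key.2] with z hz
      rw [hz, condCentered]
      ring
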